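/- **The calculus.** Terms (up to renaming of bound variables) are $$M ::= x \mid \lambda x.M \mid MM \mid M\oplus M \mid \Omega \mid \langle M,M\rangle \mid \mathtt{let}\ \langle x,y\rangle = M\ \mathtt{in}\ M .$$ Let $\mathrm{Ty}$ be any set of types with two binary operations $\sigma\multimap\tau$ and $\sigma\otimes\tau$, each of them injective (for instance simple recursive types; for a one-element $\mathrm{Ty}$ typing is just affine well-formedness of untyped terms). Writing $\Gamma,\Delta$ for a union of disjoint contexts, the affine judgement $\Gamma\vdash M:\sigma$ is given by: $\Gamma,x:\sigma\vdash x:\sigma$; $\Gamma\vdash\Omega:\sigma$; $\Gamma\vdash\lambda x.M:\sigma\multimap\tau$ if $\Gamma,x:\sigma\vdash M:\tau$; $\Gamma,\Delta\vdash MN:\tau$ if $\Gamma\vdash M:\sigma\multimap\tau$ and $\Delta\vdash N:\sigma$; $\Gamma\vdash M\oplus N:\sigma$ if $\Gamma\vdash M:\sigma$ and $\Gamma\vdash N:\sigma$; $\Gamma,\Delta\vdash\langle M,N\rangle:\sigma\otimes\tau$ if $\Gamma\vdash M:\sigma$ and $\Delta\vdash N:\tau$; $\Gamma,\Delta\vdash\mathtt{let}\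 \langle x,y\rangle=M\ \mathtt{in}\ N:\rho$ if $\Gamma\vdash M:\sigma\otimes\tau$ and $\Delta,x:\sigma,y:\tau\vdash N:\rho$. Values are the closed terms of the form $\lambda x.M$ or $\langle M,N\rangle$. The semantics $[\![M]\!]$ of a closed term is the finite value subdistribution given by the call-by-value big-step rules: $[\![\Omega]\!]=\emptyset$; $[\![V]\!]=\{V^1\}$; $[\![M\oplus N]\!]=\frac12[\![M]\!]+\frac12[\![N]\!]$; $[\![MN]\!]=\sum_{\lambda x.L,\,V}[\![M]\!](\lambda x.L)\,[\![N]\!](V)\,[\![L\{V/x\}]\!]$; $[\![\mathtt{let}\ \langle x,y\rangle=M\ \mathtt{in}\ N]\!]=\sum_{\langle L,K\rangle,V,W}[\![M]\!](\langle L,K\rangle)\,[\![L]\!](V)\,[\![K]\!](W)\,[\![N\{V/x,W/y\}]\!]$. (Stuck evaluations, if the types allow any, contribute nothing.) **Trace distance.** Traces of a type: $\epsilon$ is a trace of every type; $@V\cdot s$ is a trace of $\sigma\multimap\tau$ if $V$ is a value of type $\sigma$ and $s$ a trace of $\tau$; $\otimes L\cdot s$ is a trace of $\sigma\otimes\tau$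 if $x:\sigma,y:\tau\vdash L:\rho$ and $s$ is a trace of $\rho$. Put $\Pr(V,\epsilon)=1$, $\Pr(\lambda x.M,@V\cdot s)=\Pr(M\{V/x\},s)$, $\Pr(\langle M,N\rangle,\otimes L\cdot s)=\sum_{V,W}[\![M]\!](V)[\![N]\!](W)\Pr(L\{V/x,W/y\},s)$, the value $0$ for any other pair of a value and a nonempty trace, and $\Pr(M,s)=\sum_V[\![M]\!](V)\Pr(V,s)$ for other $M$. For closed $M,N$ of type $\sigma$, $\delta^{tr}(M,N)=\sup_s|\Pr(M,s)-\Pr(N,s)|$ over the traces $s$ of $\sigma$. **Tuple distance.** States of the tuple labelled Markov chain are tuples $\langle V_1,\dots,V_n\rangle$ of values. The action $?i$ is available if $V_i$ has a type $\sigma\otimes\tau$, and replaces the component $\langle N,L\rangle$ in position $i$ by the two components $V,W$ (of types $\sigma,\tau$) with probability $[\![N]\!](V)\cdot[\![L]\!](W)$. The action $@^i(\Gamma,C)$ is available if position $i$ has a type $\sigma\multimap\tau$, $\Gamma$ is a set of variables $x_j$ with $1\le j\le n$, $j\ne i$, each with the type of the $j$-th component, $\Gamma\vdash C:\sigma$,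 and $C$ is a variable, an abstraction or a pair; when the $i$-th component is $\lambda y.N$, it removes the components $V_j$ with $x_j\in\Gamma$ and replaces the $i$-th one by $W$ (of type $\tau$) with probability $[\![N\{C\{V_j/x_j\}_{x_j\in\Gamma}/y\}]\!](W)$, keeping the order of the remaining components. If the component in position $i$ does not have the required form, all transition probabilities are $0$. Let $\Pr(K,\epsilon)=1$ and $\Pr(K,a\cdot s)=\sum_H P(K,a,H)\Pr(H,s)$, and, for tuples $K,H$ of the same types, let $\delta^{mul}(K,H)=\sup_s|\Pr(K,s)-\Pr(H,s)|$ over the sequences $s$ of actions available successively for these types. **Theorem.** Let $I$ be a finite set of variables (listed without repetition, in any order), and let $\{V_x\}_{x\in I}$, $\{W_x\}_{x\in I}$ be families of values with $V_x,W_x$ of type $\sigma_x$. For every open term $C$ with $\{x:\sigma_x\}_{x\in I}\vdash C:\tau$, $$\delta^{tr}\bigl(C\{V_x/x\}_{x\in I},\,C\{W_x/x\}_{x\in I}\bigr)\ \le\ \delta^{mul}\bigl(\langle V_x\rangle_{x\in I},\,\langle W_x\rangle_{x\in I}\bigr).$$ -/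

import Mathlib

namespace AffineLambda

/-! ## Terms -/

/-- Terms of the probabilistic lambda-calculus with pairs, in de Bruijn notation: a variable is a
natural number and `var k` refers to the `k`-th enclosing binder, or, if there are only `m ≤ k`
enclosing binders, to the free variable `k - m`. `letp M N` is `let ⟨x, y⟩ = M in N`; it binds two
variables in `N`, `x` with index `0` and `y` with index `1`. -/
inductive Term : Type
  | var (k : ℕ)
  | lam (M : Term)
  | app (M N : Term)
  | choice (M N : Term)
  | omega
  | pair (M N : Term)
  | letp (M N : Term)

namespace Term

/-- Extension of a renaming under one binder. -/
def liftRen (r : ℕ → ℕ) : ℕ → ℕ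
  | 0 => 0
  | k + 1 => r k + 1

/-- Renaming of the free variables. -/
def rename : (ℕ → ℕ) → Term → Term
  | r, var k => var (r k)
  | r, lam M => lam (M.rename (liftRen r))
  | r, app M N => app (M.rename r) (N.rename r)
  | r, choice M N => choice (M.rename r) (N.rename r)
  | _, omega => omega
  | r, pair M N => pair (M.rename r) (N.rename r)
  | r, letp M N => letp (M.rename r) (N.rename (liftRen (liftRen r)))

/-- Extension of a substitution under one binder. -/
def liftSub (s : ℕ → Term) : ℕ → Term
  | 0 => var 0
  | k + 1 => (s k).rename Nat.succ

/-- Simultaneous capture-avoiding substitution of `s k` for every free variable `k`. -/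
def subst : (ℕ → Term) → Term → Term
  | s, var k => s k
  | s, lam M => lam (M.subst (liftSub s))
  | s, app M N => app (M.subst s) (N.subst s)
  | s, choice M N => choice (M.subst s) (N.subst s)
  | _, omega => omega
  | s, pair M N => pair (M.subst s) (N.subst s)
  | s, letp M N => letp (M.subst s) (N.subst (liftSub (liftSub s)))

/-- `M{V/x}`, where `x` is the variable with index `0`. -/
def inst (M V : Term) : Term :=
  M.subst fun k => match k with
    | 0 => V
    | k + 1 => var k

/-- `N{V/x, W/y}`, where `x` has index `0` and `y` has index `1`. -/
def inst₂ (N V W : Term) : Term :=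
  N.subst fun k => match k with
    | 0 => V
    | 1 => W
    | k + 2 => var k

/-- Abstractions and pairs. A value is a closed term of this shape. -/
def IsValue : Term → Prop
  | lam _ => True
  | pair _ _ => True
  | _ => False

/-- The open terms that become a value whenever values are substituted for their free variables:
variables, abstractions and pairs. -/
def IsOpenValue : Term → Prop
  | var _ => True
  | lam _ => True
  | pair _ _ => True
  | _ => False

end Term

/-! ## Operational semantics -/

/-- Finite (sub)distributions over terms. -/
abbrev Dist : Type := Term →₀ ℝ

/-- `∑ D(λx.L) · E(V) · F_{L,V}`. -/
noncomputable def bindApp (D E : Dist) (F : Term → Term → Dist) : Dist :=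
  D.sum fun c p => match c with
    | .lam L => E.sum fun V q => (p * q) • F L V
    | _ => 0

/-- `∑ D(⟨L, K⟩) · F_L(V) · G_K(W) · E_{V,W}`. -/
noncomputable def bindLet (D : Dist) (F G : Term → Dist) (E : Term → Term → Dist) : Dist :=
  D.sum fun c p => match c with
    | .pair L K => (F L).sum fun V q => (G K).sum fun W r => (p * q * r) • E V W
    | _ => 0

/-- The call-by-value big-step semantics `M ⇓ D`. Evaluations that get stuck (a pair in function
position, an abstraction in the head of a `let`) contribute nothing, as divergence does. -/
inductive BigStep : Term → Dist → Prop
  | omega : BigStep .omega 0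
  | value {V : Term} (hV : V.IsValue) : BigStep V (Finsupp.single V 1)
  | choice {M N : Term} {D E : Dist} (hM : BigStep M D) (hN : BigStep N E) :
      BigStep (.choice M N) ((1 / 2 : ℝ) • D + (1 / 2 : ℝ) • E)
  | app {M N : Term} {D E : Dist} {F : Term → Term → Dist}
      (hM : BigStep M D) (hN : BigStep N E)
      (hF : ∀ L V : Term, Term.lam L ∈ D.support → V ∈ E.support → BigStep (L.inst V) (F L V)) :
      BigStep (.app M N) (bindApp D E F)
  | letp {M N : Term} {D : Dist} {F G : Term → Dist} {E : Term → Term → Dist}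
      (hM : BigStep M D)
      (hF : ∀ L K : Term, Term.pair L K ∈ D.support → BigStep L (F L))
      (hG : ∀ L K : Term, Term.pair L K ∈ D.support → BigStep K (G K))
      (hE : ∀ L K V W : Term, Term.pair L K ∈ D.support → V ∈ (F L).support →
        W ∈ (G K).support → BigStep (N.inst₂ V W) (E V W)) :
      BigStep (.letp M N) (bindLet D F G E)

/-- The semantics is deterministic. -/
theorem BigStep.unique {M : Term} {D : Dist} (h : BigStep M D) :
    ∀ {D' : Dist}, BigStep M D' → D = D' := by
  induction h with
  | omega =>
    intro D' h'
    cases h' with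
    | omega => rfl
    | value hV => exact hV.elim
  | value hV =>
    intro D' h'
    cases h' <;> first | rfl | exact hV.elim
  | choice hM hN ihM ihN =>
    intro D' h'
    cases h' with
    | value hV => exact hV.elim
    | choice hM' hN' => rw [ihM hM', ihN hN']
  | app hM hN hF ihM ihN ihF =>
    intro D' h'
    cases h' with
    | value hV => exact hV.elim
    | app hM' hN' hF' =>
      obtain rfl := ihM hM'
      obtain rfl := ihN hN'
      refine Finsupp.sum_congr fun c hc => ?_
      cases c with
      | lam L =>
        refine Finsupp.sum_congr fun V hV => ?_
        rw [ihF L V hc hV (hF' L V hc hV)]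
      | _ => rfl
  | letp hM hF hG hE ihM ihF ihG ihE =>
    intro D' h'
    cases h' with
    | value hV => exact hV.elim
    | letp hM' hF' hG' hE' =>
      obtain rfl := ihM hM'
      refine Finsupp.sum_congr fun c hc => ?_
      cases c with
      | pair L K =>
        have e1 := ihF L K hc (hF' L K hc)
        have e2 := ihG L K hc (hG' L K hc)
        simp only [← e1, ← e2]
        refine Finsupp.sum_congr fun V hV => Finsupp.sum_congr fun W hW => ?_
        rw [ihE L K V W hc hV hW (hE' L K V W hc (e1 ▸ hV) (e2 ▸ hW))]
      | _ => rfl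

open Classical in
/-- `⟦M⟧`, the unique `D` with `M ⇓ D`; it exists for every closed affine term. -/
noncomputable def sem (M : Term) : Dist :=
  if h : ∃ D, BigStep M D then h.choose else 0

theorem sem_eq {M : Term} {D : Dist} (h : BigStep M D) : sem M = D := by
  have h' : ∃ D, BigStep M D := ⟨D, h⟩
  rw [sem, dif_pos h']
  exact h'.choose_spec.unique h

/-! ## Affine typing -/

/-- A set of types with a function type and a pair type constructor, both of which can be inverted.
Equations between types, such as those of recursive types, are equalities in `Ty`. -/
structure TypeAlgebra (Ty : Type*) where
  arrow : Ty → Ty → Ty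
  tensor : Ty → Ty → Ty
  arrow_inj : ∀ {a b c d : Ty}, arrow a b = arrow c d → a = c ∧ b = d
  tensor_inj : ∀ {a b c d : Ty}, tensor a b = tensor c d → a = c ∧ b = d

/-- With a single type, the typing judgement is affine well-formedness of untyped terms. -/
def TypeAlgebra.untyped : TypeAlgebra Unit where
  arrow _ _ := ()
  tensor _ _ := ()
  arrow_inj _ := ⟨rfl, rfl⟩
  tensor_inj _ := ⟨rfl, rfl⟩

/-- Typing contexts: `Γ k = some a` means that `Γ` contains the variable `k` with type `a`. -/
abbrev Ctx (Ty : Type*) : Type _ := ℕ → Option Ty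

namespace Ctx

/-- The empty context. -/
def empty {Ty : Type*} : Ctx Ty := fun _ => none

/-- The context `Γ, x : a` under a binder for `x`. -/
def cons {Ty : Type*} (a : Ty) (Γ : Ctx Ty) : Ctx Ty
  | 0 => some a
  | k + 1 => Γ k

/-- `Γ` is the union of the disjoint contexts `Δ` and `Θ`. -/
def Split {Ty : Type*} (Γ Δ Θ : Ctx Ty) : Prop :=
  ∀ k, (Δ k = Γ k ∧ Θ k = none) ∨ (Δ k = none ∧ Θ k = Γ k)

/-- The context declaring exactly the variables in `l`, the variable `x` with type `a x`. -/
def ofList {Ty : Type*} (l : List ℕ) (a : ℕ → Ty) : Ctx Ty :=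
  fun x => if x ∈ l then some (a x) else none

/-- The context declaring the variables `j ∈ J`, each with the `j`-th type of the list `T`. -/
def restrict {Ty : Type*} (T : List Ty) (J : Finset ℕ) : Ctx Ty :=
  fun j => if j ∈ J then T[j]? else none

end Ctx

/-- The affine typing judgement `Γ ⊢ M : a`. -/
inductive Typed {Ty : Type*} (A : TypeAlgebra Ty) : Ctx Ty → Term → Ty → Prop
  | var {Γ : Ctx Ty} {k : ℕ} {a : Ty} (h : Γ k = some a) : Typed A Γ (.var k) a
  | lam {Γ : Ctx Ty} {M : Term} {a b : Ty} (hM : Typed A (Γ.cons a) M b) :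
      Typed A Γ (.lam M) (A.arrow a b)
  | app {Γ Δ Θ : Ctx Ty} {M N : Term} {a b : Ty} (hs : Γ.Split Δ Θ)
      (hM : Typed A Δ M (A.arrow a b)) (hN : Typed A Θ N a) : Typed A Γ (.app M N) b
  | choice {Γ : Ctx Ty} {M N : Term} {a : Ty} (hM : Typed A Γ M a) (hN : Typed A Γ N a) :
      Typed A Γ (.choice M N) a
  | omega {Γ : Ctx Ty} {a : Ty} : Typed A Γ .omega a
  | pair {Γ Δ Θ : Ctx Ty} {M N : Term} {a b : Ty} (hs : Γ.Split Δ Θ)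
      (hM : Typed A Δ M a) (hN : Typed A Θ N b) : Typed A Γ (.pair M N) (A.tensor a b)
  | letp {Γ Δ Θ : Ctx Ty} {M N : Term} {a b c : Ty} (hs : Γ.Split Δ Θ)
      (hM : Typed A Δ M (A.tensor a b)) (hN : Typed A ((Θ.cons b).cons a) N c) :
      Typed A Γ (.letp M N) c

/-- Closed values of type `a`. -/
def ClosedValue {Ty : Type*} (A : TypeAlgebra Ty) (V : Term) (a : Ty) : Prop :=
  V.IsValue ∧ Typed A Ctx.empty V a

/-! ## The trace distance -/

/-- Actions on programs: `app V` passes the argument `V` to a function; `tens L` hands the two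
evaluated components of a pair to the term `L`, whose free variables are `x` (index `0`) and `y`
(index `1`). -/
inductive Act : Type
  | app (V : Term)
  | tens (L : Term)

/-- The traces for programs of a given type. -/
inductive TraceTyped {Ty : Type*} (A : TypeAlgebra Ty) : Ty → List Act → Prop
  | nil {a : Ty} : TraceTyped A a []
  | app {a b : Ty} {V : Term} {s : List Act} (hV : ClosedValue A V a) (hs : TraceTyped A b s) :
      TraceTyped A (A.arrow a b) (.app V :: s)
  | tens {a b c : Ty} {L : Term} {s : List Act}
      (hL : Typed A ((Ctx.empty.cons b).cons a) L c) (hs : TraceTyped A c s) :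
      TraceTyped A (A.tensor a b) (.tens L :: s)

/-- The probability that a value accepts a trace. -/
noncomputable def valueProb : List Act → Term → ℝ
  | [], _ => 1
  | .app W :: s, .lam M => (sem (M.inst W)).sum fun V p => p * valueProb s V
  | .tens L :: s, .pair M N =>
      (sem M).sum fun V p => (sem N).sum fun W q =>
        p * q * (sem (L.inst₂ V W)).sum fun U r => r * valueProb s U
  | _ :: _, _ => 0

/-- The probability that a program accepts a trace. -/
noncomputable def traceProb (M : Term) (s : List Act) : ℝ :=
  (sem M).sum fun V p => p * valueProb s V

theorem traceProb_value {V : Term} (hV : V.IsValue) (s : List Act) :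
    traceProb V s = valueProb s V := by
  rw [traceProb, sem_eq (.value hV), Finsupp.sum_single_index] <;> simp

/-- The trace distance between programs of type `a`. -/
noncomputable def traceDist {Ty : Type*} (A : TypeAlgebra Ty) (a : Ty) (M N : Term) : ℝ :=
  sSup {d : ℝ | ∃ s : List Act, TraceTyped A a s ∧ d = |traceProb M s - traceProb N s|}

/-! ## The tuple Markov chain and the tuple distance -/

/-- Actions on tuples; positions are counted from `0`. `split i` splits the pair in position `i`;
`apply i J C` applies the function in position `i` to the argument obtained from `C` by
replacing its free variables `j ∈ J` by the components in these positions. -/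
inductive TupleAct : Type
  | split (i : ℕ)
  | apply (i : ℕ) (J : Finset ℕ) (C : Term)

/-- Replace the `i`-th entry of `l` by the two entries `x`, `y`. -/
def splitAt {α : Type*} (l : List α) (i : ℕ) (x y : α) : List α :=
  l.take i ++ x :: y :: l.drop (i + 1)

/-- Remove from `l` the entries in the positions `j ∈ J`, keeping the order of the others. -/
def removeAt {α : Type*} (l : List α) (J : Finset ℕ) : List α :=
  (l.zipIdx.filter fun p => p.2 ∉ J).map Prod.fst

/-- The transition probabilities of the tuple Markov chain: `tupleStep K a H` is the probability of
moving from `K` to `H` by the action `a`. When `C` is applied at position `i`, the components used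
by `C` leave the tuple, and the result takes position `i`. -/
noncomputable def tupleStep (K : List Term) : TupleAct → (List Term →₀ ℝ)
  | .split i => match K[i]? with
    | some (.pair N L) =>
        (sem N).sum fun V p => (sem L).sum fun W q => Finsupp.single (splitAt K i V W) (p * q)
    | _ => 0
  | .apply i J C => match K[i]? with
    | some (.lam N) =>
        (sem (N.inst (C.subst fun j => K.getD j .omega))).sum fun W p =>
          Finsupp.single (removeAt (K.set i W) J) p
    | _ => 0

/-- The probability that a tuple accepts a tuple trace. -/
noncomputable def tupleProb : List TupleAct → List Term → ℝ
  | [], _ => 1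
  | a :: s, K => (tupleStep K a).sum fun H p => p * tupleProb s H

/-- The tuple traces for tuples whose components have the types in a given list. In an application
`apply i J C` at a tuple of length `n`, `J` is a set of positions other than `i`, and `C` is an open
value whose free variables belong to `J`. -/
inductive TupleTraceTyped {Ty : Type*} (A : TypeAlgebra Ty) : List Ty → List TupleAct → Prop
  | nil {T : List Ty} : TupleTraceTyped A T []
  | split {T : List Ty} {i : ℕ} {a b : Ty} {s : List TupleAct}
      (hi : T[i]? = some (A.tensor a b)) (hs : TupleTraceTyped A (splitAt T i a b) s) :
      TupleTraceTyped A T (.split i :: s)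
  | apply {T : List Ty} {i : ℕ} {J : Finset ℕ} {C : Term} {a b : Ty} {s : List TupleAct}
      (hi : T[i]? = some (A.arrow a b)) (hJ : ∀ j ∈ J, j < T.length ∧ j ≠ i)
      (hC : C.IsOpenValue) (hT : Typed A (Ctx.restrict T J) C a)
      (hs : TupleTraceTyped A (removeAt (T.set i b) J) s) :
      TupleTraceTyped A T (.apply i J C :: s)

/-- The tuple distance between tuples of values whose components have the types in `T`. -/
noncomputable def tupleDist {Ty : Type*} (A : TypeAlgebra Ty) (T : List Ty) (K H : List Term) : ℝ :=
  sSup {d : ℝ | ∃ s : List TupleAct, TupleTraceTyped A T s ∧ d = |tupleProb s K - tupleProb s H|}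

end AffineLambda

open AffineLambda

namespace AffineLambda

/-! ## Substitution -/

namespace Term

/-! The point is that, for a fixed open term `C` and a fixed trace `s`, the number Pr(C{V}, s) is
the same subconvex combination of tuple-trace acceptance probabilities for every tuple V of the
given types (`Testable`, `Typed.testable_traceProb`). Two such combinations with common weights of
total at most one differ by at most the supremum of the individual differences, which is the tuple
distance (`Testable.abs_sub_le`).

To find the combination, evaluate `C` symbolically. As long as no substituted value is inspected,
evaluation does the same thing for all V. It inspects one only by applying a variable to an open
value, or by destructuring a variable with `let`. These are exactly the two kinds of tuple action;
afterwards the tuple has been updated and a residual open term is left (`Typed.progress`). If `C` is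
itself a variable, an abstraction or a pair, the next action of `s` is moved into the term: `@V`
turns `C` into `C V`, and `⊗L` turns `C` into `let ⟨x,y⟩ = C in L`.

Affinity is used twice. Substitution never duplicates, so with a choice measured by its larger
branch every step lowers the size; this gives both the existence of the semantics of closed terms
(`Typed.sem_spec`) and the termination of the symbolic evaluation. Moreover the argument, the
function and the surrounding frame use disjoint variables, so components consumed by an application
may leave the tuple, and updating one component does not affect the rest of the term. -/

theorem liftRen_id : liftRen id = id := by
  funext k; cases k <;> rfl

theorem rename_id (M : Term) : M.rename id = M := by
  induction M <;> simp_all [rename, liftRen_id]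

theorem liftRen_comp (q r : ℕ → ℕ) :
    (fun k => liftRen q (liftRen r k)) = liftRen fun k => q (r k) := by
  funext k; cases k <;> rfl

theorem rename_rename (M : Term) (r q : ℕ → ℕ) :
    (M.rename r).rename q = M.rename fun k => q (r k) := by
  induction M generalizing r q <;> simp_all [rename, liftRen_comp]

theorem liftSub_comp_liftRen (s : ℕ → Term) (r : ℕ → ℕ) :
    (fun k => liftSub s (liftRen r k)) = liftSub fun k => s (r k) := by
  funext k; cases k <;> rfl

theorem rename_subst (M : Term) (r : ℕ → ℕ) (s : ℕ → Term) :
    (M.rename r).subst s = M.subst fun k => s (r k) := by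
  induction M generalizing r s <;> simp_all [rename, subst, liftSub_comp_liftRen]

theorem rename_liftSub (s : ℕ → Term) (r : ℕ → ℕ) :
    (fun k => (liftSub s k).rename (liftRen r)) = liftSub fun k => (s k).rename r := by
  funext k
  cases k with
  | zero => rfl
  | succ k => simp [liftSub, rename_rename, liftRen]

theorem subst_rename (M : Term) (s : ℕ → Term) (r : ℕ → ℕ) :
    (M.subst s).rename r = M.subst fun k => (s k).rename r := by
  induction M generalizing r s <;> simp_all [rename, subst, rename_liftSub]

theorem subst_liftSub (s t : ℕ → Term) :
    (fun k => (liftSub s k).subst (liftSub t)) = liftSub fun k => (s k).subst t := by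
  funext k
  cases k with
  | zero => rfl
  | succ k => simp [liftSub, rename_subst, subst_rename]

theorem subst_subst (M : Term) (s t : ℕ → Term) :
    (M.subst s).subst t = M.subst fun k => (s k).subst t := by
  induction M generalizing s t <;> simp_all [subst, subst_liftSub]

theorem liftSub_var : liftSub var = var := by
  funext k; cases k <;> rfl

theorem subst_var (M : Term) : M.subst var = M := by
  induction M <;> simp_all [subst, liftSub_var]

/-- The substitution of `V` for the variable `0` and of `s k` for the variable `k + 1`. -/
def scons (V : Term) (s : ℕ → Term) : ℕ → Term
  | 0 => V
  | k + 1 => s k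

theorem inst_eq (M V : Term) : M.inst V = M.subst (scons V var) := by
  unfold inst; congr 1

theorem inst₂_eq (N V W : Term) : N.inst₂ V W = N.subst (scons V (scons W var)) := by
  unfold inst₂; congr 1; funext k
  rcases k with _ | _ | k <;> rfl

theorem scons_subst (V : Term) (s t : ℕ → Term) :
    (fun k => (scons V s k).subst t) = scons (V.subst t) fun k => (s k).subst t := by
  funext k; cases k <;> rfl

theorem liftSub_scons (V : Term) (s t : ℕ → Term) :
    (fun k => (liftSub s k).subst (scons V t)) = scons V fun k => (s k).subst t := by
  funext k
  cases k with
  | zero => rfl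
  | succ k => simp [liftSub, rename_subst, scons]

/-- Together with `subst_liftSub_inst`, this shows that reduction commutes with closing
substitutions: contracting before or after substituting gives the same single substitution by
`scons`. The `inst₂` versions serve `let`. -/
theorem inst_subst (M V : Term) (s : ℕ → Term) :
    (M.inst V).subst s = M.subst (scons (V.subst s) s) := by
  rw [inst_eq, subst_subst, scons_subst]; rfl

theorem inst₂_subst (N V W : Term) (s : ℕ → Term) :
    (N.inst₂ V W).subst s = N.subst (scons (V.subst s) (scons (W.subst s) s)) := by
  rw [inst₂_eq, subst_subst, scons_subst, scons_subst]; rfl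

theorem subst_liftSub_inst (M V : Term) (s : ℕ → Term) :
    (M.subst (liftSub s)).inst V = M.subst (scons V s) := by
  rw [inst_eq, subst_subst, liftSub_scons]; simp only [subst_var]

theorem subst_liftSub_inst₂ (N V W : Term) (s : ℕ → Term) :
    (N.subst (liftSub (liftSub s))).inst₂ V W = N.subst (scons V (scons W s)) := by
  rw [inst₂_eq, subst_subst, liftSub_scons, liftSub_scons]; simp only [subst_var]

/-- The number of constructors other than variables and `Ω`, where only the larger one of the two
branches of a choice counts. -/
def size : Term → ℕ
  | var _ => 0
  | lam M => M.size + 1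
  | app M N => M.size + N.size + 1
  | choice M N => max M.size N.size + 1
  | omega => 0
  | pair M N => M.size + N.size + 1
  | letp M N => M.size + N.size + 1

theorem size_rename (M : Term) (r : ℕ → ℕ) : (M.rename r).size = M.size := by
  induction M generalizing r <;> simp_all [rename, size]

end Term

open Term

/-! ## Contexts and typing -/

section Typing

variable {Ty : Type*} {A : TypeAlgebra Ty}

namespace Ctx

theorem Split.symm {Γ Δ Θ : Ctx Ty} (h : Γ.Split Δ Θ) : Γ.Split Θ Δ := fun k =>
  (h k).elim (fun h => .inr ⟨h.2, h.1⟩) (fun h => .inl ⟨h.2, h.1⟩)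

theorem Split.left {Γ Δ Θ : Ctx Ty} (h : Γ.Split Δ Θ) {k : ℕ} {a : Ty} (hk : Δ k = some a) :
    Γ k = some a := by
  rcases h k with h | h <;> simp_all

theorem Split.right {Γ Δ Θ : Ctx Ty} (h : Γ.Split Δ Θ) {k : ℕ} {a : Ty} (hk : Θ k = some a) :
    Γ k = some a := h.symm.left hk

theorem Split.right_none {Γ Δ Θ : Ctx Ty} (h : Γ.Split Δ Θ) {k : ℕ} {a : Ty}
    (hk : Δ k = some a) : Θ k = none := by
  rcases h k with h | h <;> simp_all

theorem Split.left_none {Γ Δ Θ : Ctx Ty} (h : Γ.Split Δ Θ) {k : ℕ} (hk : Γ k = none) :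
    Δ k = none := by
  rcases h k with h | h <;> simp_all

theorem Split.empty : (Ctx.empty : Ctx Ty).Split Ctx.empty Ctx.empty := fun _ => .inl ⟨rfl, rfl⟩

theorem Split.empty_left (Γ : Ctx Ty) : Γ.Split Γ Ctx.empty := fun _ => .inl ⟨rfl, rfl⟩

theorem Split.eq_empty {Δ Θ : Ctx Ty} (h : Ctx.empty.Split Δ Θ) :
    Δ = Ctx.empty ∧ Θ = Ctx.empty := by
  constructor <;> funext k <;> rcases h k with h | h <;> simp_all [Ctx.empty]

theorem Split.assoc {Γ Δ Θ Δ₁ Δ₂ : Ctx Ty} (h : Γ.Split Δ Θ) (h' : Δ.Split Δ₁ Δ₂) :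
    ∃ Ξ, Γ.Split Δ₁ Ξ ∧ Ξ.Split Δ₂ Θ := by
  refine ⟨fun k => if Δ₁ k = none then Γ k else none, fun k => ?_, fun k => ?_⟩ <;>
    rcases h k with h | h <;> rcases h' k with h' | h' <;> by_cases h₁ : Δ₁ k = none <;> simp_all

theorem Split.assoc' {Γ Δ Θ Θ₁ Θ₂ : Ctx Ty} (h : Γ.Split Δ Θ) (h' : Θ.Split Θ₁ Θ₂) :
    ∃ Ξ, Γ.Split Ξ Θ₂ ∧ Ξ.Split Δ Θ₁ := by
  obtain ⟨Ξ, h₁, h₂⟩ := h.symm.assoc h'.symm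
  exact ⟨Ξ, h₁.symm, h₂.symm⟩

/-- The part of `Δ` with the variables `j` such that `o j = k`. -/
def owned (Δ : Ctx Ty) (o : ℕ → ℕ) (k : ℕ) : Ctx Ty := fun j => if o j = k then Δ j else none

open Classical in
-- Each variable of `Δ` is charged to one owner in `Γ`, so a splitting of `Γ` pulls back along `o`.
-- An owner function makes the contexts of the substituted terms disjoint automatically and avoids
-- splitting a context into a family of parts.
theorem exists_split_of_owner {Γ Γ₁ Γ₂ : Ctx Ty} (hs : Γ.Split Γ₁ Γ₂) (Δ : Ctx Ty) (o : ℕ → ℕ) :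
    ∃ Δ₁ Δ₂ : Ctx Ty, Δ.Split Δ₁ Δ₂ ∧
      (∀ k b, Γ₁ k = some b → Δ₁.owned o k = Δ.owned o k) ∧
      (∀ k b, Γ₂ k = some b → Δ₂.owned o k = Δ.owned o k) := by
  refine ⟨fun j => if Γ₁ (o j) = none then none else Δ j,
    fun j => if Γ₁ (o j) = none then Δ j else none, fun j => ?_, fun k b hk => ?_, fun k b hk => ?_⟩
  · by_cases h : Γ₁ (o j) = none <;> simp [h]
  · funext j
    by_cases h : o j = k <;> simp [owned, h, hk]
  · funext j
    have := hs.symm.right_none hk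
    by_cases h : o j = k <;> simp [owned, h, this]

end Ctx

/-! ### Stability of affine typing under renaming and substitution -/

/-- The hypothesis says that `o` is a left inverse of `r` on `Γ`: an affine judgement survives only
renamings that do not identify declared variables. -/
theorem Typed.rename {Γ : Ctx Ty} {M : Term} {a : Ty} (h : Typed A Γ M a) :
    ∀ {Δ : Ctx Ty} {r : ℕ → ℕ} (o : ℕ → ℕ),
      (∀ k b, Γ k = some b → Δ.owned o k (r k) = some b) → Typed A Δ (M.rename r) a := by
  have lift : ∀ {Γ Δ : Ctx Ty} {r o : ℕ → ℕ} (c : Ty),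
      (∀ k b, Γ k = some b → Δ.owned o k (r k) = some b) →
      ∀ k b, Γ.cons c k = some b → (Δ.cons c).owned (liftRen o) k (liftRen r k) = some b := by
    intro Γ Δ r o c h k b hk
    cases k with
    | zero => simpa [Ctx.owned, liftRen, Ctx.cons] using hk
    | succ k => simpa [Ctx.owned, liftRen, Ctx.cons] using h k b hk
  induction h with
  | @var Γ k a hk =>
    intro Δ r o h
    have := h k _ hk
    refine .var ?_
    by_cases e : o (r k) = k <;> simp_all [Ctx.owned]
  | lam hM ih => intro Δ r o h; exact .lam (ih _ (lift _ h))
  | app hs hM hN ihM ihN =>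
    intro Δ r o h
    obtain ⟨Δ₁, Δ₂, hs', h₁, h₂⟩ := Ctx.exists_split_of_owner hs Δ o
    exact .app hs' (ihM o fun k b hk => h₁ k b hk ▸ h k b (hs.left hk))
      (ihN o fun k b hk => h₂ k b hk ▸ h k b (hs.right hk))
  | choice hM hN ihM ihN => intro Δ r o h; exact .choice (ihM o h) (ihN o h)
  | omega => intros; exact .omega
  | pair hs hM hN ihM ihN =>
    intro Δ r o h
    obtain ⟨Δ₁, Δ₂, hs', h₁, h₂⟩ := Ctx.exists_split_of_owner hs Δ o
    exact .pair hs' (ihM o fun k b hk => h₁ k b hk ▸ h k b (hs.left hk))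
      (ihN o fun k b hk => h₂ k b hk ▸ h k b (hs.right hk))
  | letp hs hM hN ihM ihN =>
    intro Δ r o h
    obtain ⟨Δ₁, Δ₂, hs', h₁, h₂⟩ := Ctx.exists_split_of_owner hs Δ o
    exact .letp hs' (ihM o fun k b hk => h₁ k b hk ▸ h k b (hs.left hk))
      (ihN _ (lift _ (lift _ fun k b hk => h₂ k b hk ▸ h k b (hs.right hk))))

theorem Typed.weaken {Γ Δ : Ctx Ty} {M : Term} {a : Ty} (h : Typed A Γ M a)
    (hΔ : ∀ k b, Γ k = some b → Δ k = some b) : Typed A Δ M a := by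
  rw [← rename_id M]
  exact h.rename id fun k b hk => by simpa [Ctx.owned] using hΔ k b hk

theorem Typed.subst {Γ : Ctx Ty} {M : Term} {a : Ty} (h : Typed A Γ M a) :
    ∀ {Δ : Ctx Ty} {s : ℕ → Term} (o : ℕ → ℕ),
      (∀ k b, Γ k = some b → Typed A (Δ.owned o k) (s k) b) → Typed A Δ (M.subst s) a := by
  have lift : ∀ {Γ Δ : Ctx Ty} {s : ℕ → Term} {o : ℕ → ℕ} (c : Ty),
      (∀ k b, Γ k = some b → Typed A (Δ.owned o k) (s k) b) →
      ∀ k b, Γ.cons c k = some b →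
        Typed A ((Δ.cons c).owned (liftRen o) k) (liftSub s k) b := by
    intro Γ Δ s o c h k b hk
    cases k with
    | zero => exact .var (by simpa [Ctx.owned, liftRen, Ctx.cons] using hk)
    | succ k =>
      refine (h k b hk).rename Nat.pred fun j d hj => ?_
      simpa [Ctx.owned, liftRen, Ctx.cons] using hj
  induction h with
  | @var Γ k a hk =>
    intro Δ s o h
    refine (h k _ hk).weaken fun j b hj => ?_
    by_cases e : o j = k <;> simp_all [Ctx.owned]
  | lam hM ih => intro Δ s o h; exact .lam (ih _ (lift _ h))
  | app hs hM hN ihM ihN =>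
    intro Δ s o h
    obtain ⟨Δ₁, Δ₂, hs', h₁, h₂⟩ := Ctx.exists_split_of_owner hs Δ o
    exact .app hs' (ihM o fun k b hk => h₁ k b hk ▸ h k b (hs.left hk))
      (ihN o fun k b hk => h₂ k b hk ▸ h k b (hs.right hk))
  | choice hM hN ihM ihN => intro Δ s o h; exact .choice (ihM o h) (ihN o h)
  | omega => intros; exact .omega
  | pair hs hM hN ihM ihN =>
    intro Δ s o h
    obtain ⟨Δ₁, Δ₂, hs', h₁, h₂⟩ := Ctx.exists_split_of_owner hs Δ o
    exact .pair hs' (ihM o fun k b hk => h₁ k b hk ▸ h k b (hs.left hk))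
      (ihN o fun k b hk => h₂ k b hk ▸ h k b (hs.right hk))
  | letp hs hM hN ihM ihN =>
    intro Δ s o h
    obtain ⟨Δ₁, Δ₂, hs', h₁, h₂⟩ := Ctx.exists_split_of_owner hs Δ o
    exact .letp hs' (ihM o fun k b hk => h₁ k b hk ▸ h k b (hs.left hk))
      (ihN _ (lift _ (lift _ fun k b hk => h₂ k b hk ▸ h k b (hs.right hk))))

theorem liftSub_congr {Γ : Ctx Ty} {s t : ℕ → Term} (c : Ty)
    (h : ∀ k b, Γ k = some b → s k = t k) :
    ∀ k b, Γ.cons c k = some b → liftSub s k = liftSub t k := by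
  intro k b hk
  cases k with
  | zero => rfl
  | succ k => simp [liftSub, h k b hk]

/-- Used for locality: a frame ignores updates of variables outside its context, and a residual term
ignores the components that have left the tuple. -/
theorem Typed.subst_congr {Γ : Ctx Ty} {M : Term} {a : Ty} (h : Typed A Γ M a) :
    ∀ {s t : ℕ → Term}, (∀ k b, Γ k = some b → s k = t k) → M.subst s = M.subst t := by
  induction h with
  | var hk => intro s t h; exact h _ _ hk
  | lam hM ih => intro s t h; simp only [Term.subst, ih (liftSub_congr _ h)]
  | app hs hM hN ihM ihN =>
    intro s t h
    simp only [Term.subst, ihM fun k b hk => h k b (hs.left hk),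
      ihN fun k b hk => h k b (hs.right hk)]
  | choice hM hN ihM ihN => intro s t h; simp only [Term.subst, ihM h, ihN h]
  | omega => intros; rfl
  | pair hs hM hN ihM ihN =>
    intro s t h
    simp only [Term.subst, ihM fun k b hk => h k b (hs.left hk),
      ihN fun k b hk => h k b (hs.right hk)]
  | letp hs hM hN ihM ihN =>
    intro s t h
    simp only [Term.subst, ihM fun k b hk => h k b (hs.left hk),
      ihN (liftSub_congr _ (liftSub_congr _ fun k b hk => h k b (hs.right hk)))]

theorem Typed.subst_eq_self {M : Term} {a : Ty} (h : Typed A Ctx.empty M a) (s : ℕ → Term) :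
    M.subst s = M :=
  (h.subst_congr fun _ _ hk => nomatch hk).trans (subst_var M)

/-! ### Affine substitution does not duplicate -/

theorem size_liftSub {Γ : Ctx Ty} {s : ℕ → Term} {S : Finset ℕ} (c : Ty)
    (h : ∀ k b, Γ k = some b → k ∉ S → (s k).size = 0) :
    ∀ k b, Γ.cons c k = some b → k ∉ S.map ⟨_, Nat.succ_injective⟩ → (liftSub s k).size = 0 := by
  intro k b hk hS
  cases k with
  | zero => rfl
  | succ k => simpa [liftSub, size_rename] using h k b hk (by simpa using hS)

theorem sum_size_liftSub (s : ℕ → Term) (S : Finset ℕ) :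
    ∑ k ∈ S.map ⟨_, Nat.succ_injective⟩, (liftSub s k).size = ∑ k ∈ S, (s k).size := by
  simp [liftSub, size_rename]

/-- Each variable is used at most once, except that the branches of a choice share variables; there
`size` takes a maximum, so the sum is still paid only once. The finite set `S` contains all declared
variables whose substituted terms have positive size. -/
theorem Typed.size_subst_le {Γ : Ctx Ty} {M : Term} {a : Ty} (h : Typed A Γ M a) :
    ∀ {s : ℕ → Term} {S : Finset ℕ}, (∀ k b, Γ k = some b → k ∉ S → (s k).size = 0) →
      (M.subst s).size ≤ M.size + ∑ k ∈ S, (s k).size := by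
  classical
  have split : ∀ {Γ Γ₁ Γ₂ : Ctx Ty} {s : ℕ → Term} {S : Finset ℕ}, Γ.Split Γ₁ Γ₂ →
      (∀ k b, Γ k = some b → k ∉ S → (s k).size = 0) →
      ∃ S₁ S₂ : Finset ℕ, (∀ k b, Γ₁ k = some b → k ∉ S₁ → (s k).size = 0) ∧
        (∀ k b, Γ₂ k = some b → k ∉ S₂ → (s k).size = 0) ∧
        ∑ k ∈ S₁, (s k).size + ∑ k ∈ S₂, (s k).size = ∑ k ∈ S, (s k).size := by
    intro Γ Γ₁ Γ₂ s S hs h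
    -- Partitioning `S` by membership in `Γ₂` gives each side the variables it may use, and the two
    -- sums add up exactly.
    refine ⟨S.filter fun k => Γ₂ k = none, S.filter fun k => ¬ Γ₂ k = none, ?_, ?_,
      Finset.sum_filter_add_sum_filter_not _ _ _⟩
    · intro k b hk hS
      exact h k b (hs.left hk) fun hk' => hS (by simp [hk', hs.right_none hk])
    · intro k b hk hS
      exact h k b (hs.right hk) fun hk' => hS (by simp [hk', hk])
  induction h with
  | @var Γ k a hk =>
    intro s S h
    by_cases hS : k ∈ S
    · have := Finset.single_le_sum (f := fun k => (s k).size) (fun _ _ => Nat.zero_le _) hS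
      simpa [Term.subst, size] using this
    · simp [Term.subst, h _ _ hk hS]
  | lam hM ih =>
    intro s S h
    have := ih (size_liftSub _ h)
    rw [sum_size_liftSub] at this
    simp only [Term.subst, size]
    omega
  | app hs hM hN ihM ihN =>
    intro s S h
    obtain ⟨S₁, S₂, h₁, h₂, e⟩ := split hs h
    have := ihM h₁
    have := ihN h₂
    simp only [Term.subst, size]
    omega
  | choice hM hN ihM ihN =>
    intro s S h
    have := ihM h
    have := ihN h
    simp only [Term.subst, size]
    omega
  | omega => intros; exact Nat.zero_le _
  | pair hs hM hN ihM ihN =>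
    intro s S h
    obtain ⟨S₁, S₂, h₁, h₂, e⟩ := split hs h
    have := ihM h₁
    have := ihN h₂
    simp only [Term.subst, size]
    omega
  | letp hs hM hN ihM ihN =>
    intro s S h
    obtain ⟨S₁, S₂, h₁, h₂, e⟩ := split hs h
    have := ihM h₁
    have := ihN (size_liftSub _ (size_liftSub _ h₂))
    rw [sum_size_liftSub, sum_size_liftSub] at this
    simp only [Term.subst, size]
    omega

theorem Typed.size_inst_le {Γ : Ctx Ty} {M : Term} {a b : Ty} (h : Typed A (Γ.cons a) M b)
    (V : Term) : (M.inst V).size ≤ M.size + V.size := by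
  rw [inst_eq]
  refine (h.size_subst_le (S := {0}) fun k c _ hk => ?_).trans (by simp [scons])
  cases k with
  | zero => simp at hk
  | succ k => rfl

theorem Typed.size_inst₂_le {Γ : Ctx Ty} {N : Term} {a b c : Ty}
    (h : Typed A ((Γ.cons b).cons a) N c) (V W : Term) :
    (N.inst₂ V W).size ≤ N.size + V.size + W.size := by
  rw [inst₂_eq]
  refine (h.size_subst_le (S := {0, 1}) fun k c _ hk => ?_).trans (by simp [scons]; omega)
  rcases k with _ | _ | k
  · simp at hk
  · simp at hk
  · rfl

theorem Typed.inst {Γ Δ Θ : Ctx Ty} {M V : Term} {a b : Ty} (hs : Γ.Split Δ Θ)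
    (hM : Typed A (Δ.cons a) M b) (hV : Typed A Θ V a) : Typed A Γ (M.inst V) b := by
  classical
  rw [inst_eq]
  -- The variables of `V` belong to the bound variable `0`; every other `j` belongs to itself, which
  -- is `j + 1` under the binder.
  refine hM.subst (fun j => if Θ j = none then j + 1 else 0) fun k c hk => ?_
  cases k with
  | zero =>
    obtain rfl : a = c := by simpa [Ctx.cons] using hk
    refine hV.weaken fun j d hj => ?_
    simp [Ctx.owned, hj, hs.right hj]
  | succ k =>
    refine .var ?_
    have hk : Δ k = some c := hk
    simp [Ctx.owned, hs.right_none hk, hs.left hk]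

theorem Typed.inst₂ {Γ Δ₁ Δ₂ Δ Θ : Ctx Ty} {N V W : Term} {a b c : Ty} (hs : Γ.Split Δ Θ)
    (hs' : Δ.Split Δ₁ Δ₂) (hN : Typed A ((Θ.cons b).cons a) N c) (hV : Typed A Δ₁ V a)
    (hW : Typed A Δ₂ W b) : Typed A Γ (N.inst₂ V W) c := by
  classical
  rw [inst₂_eq]
  refine hN.subst (fun j => if Δ₁ j = none then if Δ₂ j = none then j + 2 else 1 else 0)
    fun k d hk => ?_
  rcases k with _ | _ | k
  · obtain rfl : a = d := by simpa [Ctx.cons] using hk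
    refine hV.weaken fun j d hj => ?_
    simp [Ctx.owned, hj, hs.left (hs'.left hj)]
  · obtain rfl : b = d := by simpa [Ctx.cons] using hk
    refine hW.weaken fun j d hj => ?_
    simp [Ctx.owned, hj, hs'.symm.right_none hj, hs.left (hs'.right hj)]
  · refine .var ?_
    have hk : Θ k = some d := hk
    have h₀ := hs.symm.right_none hk
    simp [Ctx.owned, hs'.left_none h₀, hs'.symm.left_none h₀, hs.right hk]

/-- `V` substitutes closed values of the right types for the variables in `Γ`. -/
def Closes (A : TypeAlgebra Ty) (Γ : Ctx Ty) (V : ℕ → Term) : Prop :=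
  ∀ k a, Γ k = some a → ClosedValue A (V k) a

theorem Closes.left {Γ Δ Θ : Ctx Ty} {V : ℕ → Term} (h : Closes A Γ V) (hs : Γ.Split Δ Θ) :
    Closes A Δ V := fun k a hk => h k a (hs.left hk)

theorem Closes.right {Γ Δ Θ : Ctx Ty} {V : ℕ → Term} (h : Closes A Γ V) (hs : Γ.Split Δ Θ) :
    Closes A Θ V := fun k a hk => h k a (hs.right hk)

theorem Closes.update {Γ : Ctx Ty} {V : ℕ → Term} {a : Ty} {X : Term} (h : Closes A Γ V) (i : ℕ)
    (hX : ClosedValue A X a) : Closes A (Function.update Γ i (some a)) (Function.update V i X) := by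
  intro k c hk
  by_cases e : k = i
  · subst e
    obtain rfl : a = c := by simpa using hk
    simpa using hX
  · rw [Function.update_of_ne e] at hk ⊢
    exact h k c hk

theorem Typed.subst_closes {Γ : Ctx Ty} {M : Term} {a : Ty} {V : ℕ → Term} (h : Typed A Γ M a)
    (hV : Closes A Γ V) : Typed A Ctx.empty (M.subst V) a :=
  h.subst id fun k b hk => (hV k b hk).2.weaken fun _ _ hj => nomatch hj

theorem Typed.isValue_subst {Γ : Ctx Ty} {M : Term} {a : Ty} {V : ℕ → Term} (h : Typed A Γ M a)
    (hM : M.IsOpenValue) (hV : Closes A Γ V) : (M.subst V).IsValue := by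
  cases h with
  | var hk => exact (hV _ _ hk).1
  | lam | pair => trivial
  | app | choice | omega | letp => exact hM.elim

/-- This inversion and `Typed.pair_inv` are where injectivity of the two type constructors enters.
-/
theorem Typed.lam_inv {Γ : Ctx Ty} {M : Term} {a b : Ty} (h : Typed A Γ (.lam M) (A.arrow a b)) :
    Typed A (Γ.cons a) M b := by
  generalize hc : A.arrow a b = c at h
  cases h with
  | lam hM =>
    obtain ⟨rfl, rfl⟩ := A.arrow_inj hc
    exact hM

theorem Typed.pair_inv {Γ : Ctx Ty} {M N : Term} {a b : Ty}
    (h : Typed A Γ (.pair M N) (A.tensor a b)) :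
    ∃ Δ Θ, Γ.Split Δ Θ ∧ Typed A Δ M a ∧ Typed A Θ N b := by
  generalize hc : A.tensor a b = c at h
  cases h with
  | pair hs hM hN =>
    obtain ⟨rfl, rfl⟩ := A.tensor_inj hc
    exact ⟨_, _, hs, hM, hN⟩

end Typing

/-! ## Finite subdistributions -/

section Bind

variable {α β E : Type*} [AddCommGroup E] [Module ℝ E]

/-- The sum `∑ D(c) · G_c`. -/
noncomputable def bind (D : α →₀ ℝ) (G : α → E) : E := Finsupp.linearCombination ℝ G D

theorem bind_eq_sum (D : α →₀ ℝ) (G : α → E) : bind D G = D.sum fun c p => p • G c := rfl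

@[simp] theorem bind_zero (G : α → E) : bind (0 : α →₀ ℝ) G = 0 := map_zero _

@[simp] theorem bind_add (D D' : α →₀ ℝ) (G : α → E) : bind (D + D') G = bind D G + bind D' G :=
  map_add _ _ _

@[simp] theorem bind_smul (r : ℝ) (D : α →₀ ℝ) (G : α → E) : bind (r • D) G = r • bind D G :=
  map_smul _ _ _

@[simp] theorem bind_single (c : α) (r : ℝ) (G : α → E) :
    bind (Finsupp.single c r) G = r • G c := Finsupp.linearCombination_single _ _ _

theorem bind_congr {D : α →₀ ℝ} {G G' : α → E} (h : ∀ c ∈ D.support, G c = G' c) :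
    bind D G = bind D G' := by
  simp only [bind_eq_sum]
  exact Finsupp.sum_congr fun c hc => by rw [h c hc]

@[simp] theorem bind_zero_right (D : α →₀ ℝ) : bind D (fun _ => (0 : E)) = 0 := by
  simp [bind_eq_sum]

theorem bind_add_right (D : α →₀ ℝ) (G G' : α → E) :
    bind D (fun c => G c + G' c) = bind D G + bind D G' := by
  simp [bind_eq_sum, Finsupp.sum_add]

theorem bind_smul_right (r : ℝ) (D : α →₀ ℝ) (G : α → E) :
    bind D (fun c => r • G c) = r • bind D G := by
  simp [bind_eq_sum, Finsupp.smul_sum, smul_comm r]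

theorem bind_bind (D : α →₀ ℝ) (F : α → β →₀ ℝ) (G : β → E) :
    bind (bind D F) G = bind D fun c => bind (F c) G := by
  rw [bind_eq_sum D F, bind_eq_sum D]
  unfold bind
  rw [Finsupp.sum, map_sum]
  simp [Finsupp.sum]

/-- Fubini for finite sums. It makes the evaluation order of independent subterms irrelevant, which
lets a frame have its hole in an argument or in a second component. -/
theorem bind_comm (D : α →₀ ℝ) (D' : β →₀ ℝ) (G : α → β → E) :
    (bind D fun c => bind D' fun d => G c d) = bind D' fun d => bind D fun c => G c d := by
  simp only [bind_eq_sum, Finsupp.smul_sum]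
  rw [Finsupp.sum_comm]
  exact Finsupp.sum_congr fun _ _ => Finsupp.sum_congr fun _ _ => smul_comm _ _ _

theorem exists_of_mem_support_bind {D : α →₀ ℝ} {G : α → β →₀ ℝ} {d : β}
    (h : d ∈ (bind D G).support) : ∃ c ∈ D.support, d ∈ (G c).support := by
  classical
  have := Finsupp.support_sum h
  simp only [Finset.mem_biUnion] at this
  obtain ⟨c, hc, hd⟩ := this
  exact ⟨c, hc, Finsupp.support_smul hd⟩

/-- Nonnegative weights with total mass at most one. -/
def IsSubdist (D : α →₀ ℝ) : Prop := (∀ c, 0 ≤ D c) ∧ bind D (fun _ => (1 : ℝ)) ≤ 1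

theorem IsSubdist.bind_mem {D : α →₀ ℝ} (h : IsSubdist D) {f : α → ℝ}
    (hf : ∀ c ∈ D.support, f c ∈ Set.Icc (0 : ℝ) 1) : bind D f ∈ Set.Icc (0 : ℝ) 1 := by
  refine ⟨Finset.sum_nonneg fun c hc => mul_nonneg (h.1 c) (hf c hc).1, le_trans ?_ h.2⟩
  exact Finset.sum_le_sum fun c hc => mul_le_mul_of_nonneg_left (hf c hc).2 (h.1 c)

theorem IsSubdist.zero : IsSubdist (0 : α →₀ ℝ) := ⟨fun _ => le_rfl, by simp⟩

theorem IsSubdist.single (c : α) : IsSubdist (Finsupp.single c (1 : ℝ)) := by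
  classical
  refine ⟨fun d => ?_, by simp⟩
  rw [Finsupp.single_apply]
  split <;> norm_num

theorem IsSubdist.bind {D : α →₀ ℝ} (h : IsSubdist D) {G : α → β →₀ ℝ}
    (hG : ∀ c ∈ D.support, IsSubdist (G c)) : IsSubdist (bind D G) := by
  constructor
  · intro d
    rw [bind_eq_sum, Finsupp.sum_apply]
    exact Finset.sum_nonneg fun c hc => mul_nonneg (h.1 c) ((hG c hc).1 d)
  · rw [bind_bind]
    exact (h.bind_mem fun c hc => (hG c hc).bind_mem fun _ _ => ⟨zero_le_one, le_rfl⟩).2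

end Bind

/-! ## The semantics of closed affine terms -/

section Semantics

variable {E : Type*} [AddCommGroup E] [Module ℝ E]

/-- `⟦L{V/x}⟧` if `c` is `λx.L`. -/
noncomputable def applyVal (c V : Term) : Dist :=
  match c with
  | .lam L => sem (L.inst V)
  | _ => 0

/-- `∑ ⟦L⟧(V) · ⟦K⟧(W) · G_{V,W}` if `c` is `⟨L, K⟩`. -/
noncomputable def splitVal (c : Term) (G : Term → Term → E) : E :=
  match c with
  | .pair L K => bind (sem L) fun V => bind (sem K) fun W => G V W
  | _ => 0

theorem bind_splitVal {α : Type*} (c : Term) (G : Term → Term → α →₀ ℝ) (H : α → E) :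
    bind (splitVal c G) H = splitVal c fun V W => bind (G V W) H := by
  cases c <;> simp [splitVal, bind_bind]

theorem bindApp_eq (D D' : Dist) (F : Term → Term → Dist) :
    bindApp D D' F = bind D fun c => match c with
      | .lam L => bind D' fun V => F L V
      | _ => 0 := by
  refine Finsupp.sum_congr fun c _ => ?_
  cases c <;> simp [bind_eq_sum, Finsupp.smul_sum, mul_smul]

theorem bindLet_eq (D : Dist) (F G : Term → Dist) (H : Term → Term → Dist) :
    bindLet D F G H = bind D fun c => match c with
      | .pair L K => bind (F L) fun V => bind (G K) fun W => H V W
      | _ => 0 := by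
  refine Finsupp.sum_congr fun c _ => ?_
  cases c <;> simp [bind_eq_sum, Finsupp.smul_sum, mul_smul]

/-- Needed to keep acceptance probabilities in [0,1], so that the supremum defining the tuple
distance is over a bounded set. -/
theorem BigStep.isSubdist {M : Term} {D : Dist} (h : BigStep M D) : IsSubdist D := by
  induction h with
  | omega => exact .zero
  | value => exact .single _
  | @choice M N D D' _ _ ihM ihN =>
    refine ⟨fun c => ?_, ?_⟩
    · have := ihM.1 c
      have := ihN.1 c
      simp only [Finsupp.add_apply, Finsupp.smul_apply, smul_eq_mul]
      linarith
    · have := ihM.2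
      have := ihN.2
      simp only [bind_add, bind_smul, smul_eq_mul]
      linarith
  | app _ _ _ ihM ihN ihF =>
    rw [bindApp_eq]
    refine ihM.bind fun c hc => ?_
    cases c with
    | lam L => exact ihN.bind fun V hV => ihF L V hc hV
    | _ => exact .zero
  | letp _ _ _ _ ihM ihF ihG ihE =>
    rw [bindLet_eq]
    refine ihM.bind fun c hc => ?_
    cases c with
    | pair L K =>
      exact (ihF L K hc).bind fun V hV => (ihG L K hc).bind fun W hW => ihE L K V W hc hV hW
    | _ => exact .zero

theorem isSubdist_sem (M : Term) : IsSubdist (sem M) := by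
  by_cases h : ∃ D, BigStep M D
  · obtain ⟨D, hD⟩ := h
    rw [sem_eq hD]
    exact hD.isSubdist
  · rw [sem, dif_neg h]
    exact .zero

theorem isSubdist_applyVal (c V : Term) : IsSubdist (applyVal c V) := by
  cases c <;> first | exact isSubdist_sem _ | exact .zero

theorem isSubdist_splitVal {α : Type*} (c : Term) {G : Term → Term → α →₀ ℝ}
    (hG : ∀ V W, IsSubdist (G V W)) : IsSubdist (splitVal c G) := by
  cases c with
  | pair L K => exact (isSubdist_sem L).bind fun V _ => (isSubdist_sem K).bind fun W _ => hG V W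
  | _ => exact .zero

theorem sem_value {V : Term} (hV : V.IsValue) : sem V = Finsupp.single V 1 := sem_eq (.value hV)

@[simp] theorem sem_omega : sem .omega = 0 := sem_eq .omega

variable {Ty : Type*} {A : TypeAlgebra Ty}

/-- Strong induction on size. Existence has to be proved together with the size bound on results:
only because values are no larger than the program producing them is the contracted redex smaller
than the original term, so that the induction applies to it. -/
theorem Typed.sem_spec {M : Term} {a : Ty} (h : Typed A Ctx.empty M a) :
    BigStep M (sem M) ∧ ∀ V ∈ (sem M).support, ClosedValue A V a ∧ V.size ≤ M.size := by
  induction n : M.size using Nat.strong_induction_on generalizing M a with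
  | _ n ih =>
  subst n
  have value : ∀ {V : Term}, V.IsValue → Typed A Ctx.empty V a →
      BigStep V (sem V) ∧ ∀ W ∈ (sem V).support, ClosedValue A W a ∧ W.size ≤ V.size := by
    intro V hV h
    rw [sem_value hV]
    refine ⟨.value hV, fun W hW => ?_⟩
    obtain rfl : W = V := by
      simpa using Finsupp.support_single_subset hW
    exact ⟨⟨hV, h⟩, le_rfl⟩
  cases h with
  | var hk => exact nomatch hk
  | lam hM => exact value trivial (.lam hM)
  | pair hs hM hN => exact value trivial (.pair hs hM hN)
  | omega =>
    rw [sem_omega]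
    exact ⟨.omega, fun V hV => by simp at hV⟩
  | @choice _ M N _ hM hN =>
    obtain ⟨bM, sM⟩ := ih _ (by simp only [size]; omega) hM rfl
    obtain ⟨bN, sN⟩ := ih _ (by simp only [size]; omega) hN rfl
    have b := BigStep.choice bM bN
    rw [sem_eq b]
    refine ⟨b, fun V hV => ?_⟩
    classical
    rcases Finset.mem_union.1 (Finsupp.support_add hV) with hV | hV
    · have := sM V (Finsupp.support_smul hV)
      exact ⟨this.1, by have := this.2; simp only [size]; omega⟩
    · have := sN V (Finsupp.support_smul hV)
      exact ⟨this.1, by have := this.2; simp only [size]; omega⟩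
  | @app _ _ _ M N c _ hs hM hN =>
    obtain ⟨rfl, rfl⟩ := hs.eq_empty
    obtain ⟨bM, sM⟩ := ih _ (by simp only [size]; omega) hM rfl
    obtain ⟨bN, sN⟩ := ih _ (by simp only [size]; omega) hN rfl
    have key : ∀ L V : Term, Term.lam L ∈ (sem M).support → V ∈ (sem N).support →
        Typed A Ctx.empty (L.inst V) a ∧ (L.inst V).size ≤ M.size + N.size := by
      intro L V hL hV
      have hL := sM _ hL
      have hV := sN _ hV
      refine ⟨.inst Ctx.Split.empty hL.1.2.lam_inv hV.1.2, ?_⟩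
      have := hL.1.2.lam_inv.size_inst_le V
      have := hL.2
      simp only [size] at this
      omega
    have ihL := fun L V hL hV => ih _ (by have := (key L V hL hV).2; simp only [size]; omega)
      (key L V hL hV).1 rfl
    have b := BigStep.app (F := fun L V => sem (L.inst V)) bM bN
      fun L V hL hV => (ihL L V hL hV).1
    rw [sem_eq b]
    refine ⟨b, fun W hW => ?_⟩
    rw [bindApp_eq] at hW
    obtain ⟨c, hc, hW⟩ := exists_of_mem_support_bind hW
    cases c with
    | lam L =>
      obtain ⟨V, hV, hW⟩ := exists_of_mem_support_bind hW
      have := (ihL L V hc hV).2 W hW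
      refine ⟨this.1, ?_⟩
      have := this.2
      have := (key L V hc hV).2
      simp only [size]
      omega
    | _ => simp at hW
  | @letp _ _ _ M N c d _ hs hM hN =>
    obtain ⟨rfl, rfl⟩ := hs.eq_empty
    obtain ⟨bM, sM⟩ := ih _ (by simp only [size]; omega) hM rfl
    have pr : ∀ L K : Term, Term.pair L K ∈ (sem M).support →
        Typed A Ctx.empty L c ∧ Typed A Ctx.empty K d ∧ L.size + K.size + 1 ≤ M.size := by
      intro L K h
      have h := sM _ h
      obtain ⟨Δ, Θ, hs, hL, hK⟩ := h.1.2.pair_inv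
      obtain ⟨rfl, rfl⟩ := hs.eq_empty
      exact ⟨hL, hK, h.2⟩
    have ihL := fun L K h => ih L.size (by have := (pr L K h).2.2; simp only [size]; omega)
      (pr L K h).1 rfl
    have ihK := fun L K h => ih K.size (by have := (pr L K h).2.2; simp only [size]; omega)
      (pr L K h).2.1 rfl
    have key : ∀ L K V W : Term, Term.pair L K ∈ (sem M).support → V ∈ (sem L).support →
        W ∈ (sem K).support →
        Typed A Ctx.empty (N.inst₂ V W) a ∧ (N.inst₂ V W).size ≤ M.size + N.size := by
      intro L K V W h hV hW
      have hV := (ihL L K h).2 V hV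
      have hW := (ihK L K h).2 W hW
      refine ⟨.inst₂ Ctx.Split.empty Ctx.Split.empty hN hV.1.2 hW.1.2, ?_⟩
      have := hN.size_inst₂_le V W
      have := (pr L K h).2.2
      omega
    have ihN := fun L K V W h hV hW => ih _
      (by have := (key L K V W h hV hW).2; simp only [size]; omega) (key L K V W h hV hW).1 rfl
    have b := BigStep.letp (F := sem) (G := sem) (E := fun V W => sem (N.inst₂ V W)) bM
      (fun L K h => (ihL L K h).1) (fun L K h => (ihK L K h).1)
      fun L K V W h hV hW => (ihN L K V W h hV hW).1
    rw [sem_eq b]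
    refine ⟨b, fun U hU => ?_⟩
    rw [bindLet_eq] at hU
    obtain ⟨c, hc, hU⟩ := exists_of_mem_support_bind hU
    cases c with
    | pair L K =>
      obtain ⟨V, hV, hU⟩ := exists_of_mem_support_bind hU
      obtain ⟨W, hW, hU⟩ := exists_of_mem_support_bind hU
      have := (ihN L K V W hc hV hW).2 U hU
      refine ⟨this.1, ?_⟩
      have := this.2
      have := (key L K V W hc hV hW).2
      simp only [size]
      omega
    | _ => simp at hU

theorem Typed.bigStep {M : Term} {a : Ty} (h : Typed A Ctx.empty M a) : BigStep M (sem M) :=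
  h.sem_spec.1

theorem Typed.closedValue {M V : Term} {a : Ty} (h : Typed A Ctx.empty M a)
    (hV : V ∈ (sem M).support) : ClosedValue A V a := (h.sem_spec.2 V hV).1

theorem ClosedValue.applyVal {c V W : Term} {a b : Ty} (hc : ClosedValue A c (A.arrow a b))
    (hV : ClosedValue A V a) (hW : W ∈ (applyVal c V).support) : ClosedValue A W b := by
  cases c with
  | lam L => exact (Typed.inst Ctx.Split.empty hc.2.lam_inv hV.2).closedValue hW
  | _ => simp [AffineLambda.applyVal] at hW

theorem ClosedValue.splitVal_congr {c : Term} {a b : Ty} (hc : ClosedValue A c (A.tensor a b))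
    {G G' : Term → Term → E}
    (h : ∀ V W, ClosedValue A V a → ClosedValue A W b → G V W = G' V W) :
    splitVal c G = splitVal c G' := by
  cases c with
  | pair L K =>
    obtain ⟨Δ, Θ, hs, hL, hK⟩ := hc.2.pair_inv
    obtain ⟨rfl, rfl⟩ := hs.eq_empty
    exact bind_congr fun V hV => bind_congr fun W hW => h V W (hL.closedValue hV)
      (hK.closedValue hW)
  | _ => rfl

theorem Typed.sem_choice {M N : Term} {a : Ty} (hM : Typed A Ctx.empty M a)
    (hN : Typed A Ctx.empty N a) :
    sem (.choice M N) = (1 / 2 : ℝ) • sem M + (1 / 2 : ℝ) • sem N :=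
  sem_eq (.choice hM.bigStep hN.bigStep)

theorem Typed.sem_app {M N : Term} {a b : Ty} (hM : Typed A Ctx.empty M (A.arrow a b))
    (hN : Typed A Ctx.empty N a) :
    sem (.app M N) = bind (sem M) fun c => bind (sem N) fun V => applyVal c V := by
  rw [sem_eq (.app (F := fun L V => sem (L.inst V)) hM.bigStep hN.bigStep fun L V hL hV =>
    (Typed.inst Ctx.Split.empty (hM.closedValue hL).2.lam_inv (hN.closedValue hV).2).bigStep),
    bindApp_eq]
  refine bind_congr fun c _ => ?_
  cases c <;> simp [applyVal]

theorem Typed.sem_letp {M N : Term} {a b c : Ty} (hM : Typed A Ctx.empty M (A.tensor a b))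
    (hN : Typed A ((Ctx.empty.cons b).cons a) N c) :
    sem (.letp M N) = bind (sem M) fun c => splitVal c fun V W => sem (N.inst₂ V W) := by
  have pr : ∀ L K : Term, Term.pair L K ∈ (sem M).support →
      Typed A Ctx.empty L a ∧ Typed A Ctx.empty K b := by
    intro L K h
    obtain ⟨Δ, Θ, hs, hL, hK⟩ := (hM.closedValue h).2.pair_inv
    obtain ⟨rfl, rfl⟩ := hs.eq_empty
    exact ⟨hL, hK⟩
  rw [sem_eq (.letp (F := sem) (G := sem) (E := fun V W => sem (N.inst₂ V W)) hM.bigStep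
    (fun L K h => (pr L K h).1.bigStep) (fun L K h => (pr L K h).2.bigStep)
    fun L K V W h hV hW => (Typed.inst₂ Ctx.Split.empty Ctx.Split.empty hN
      ((pr L K h).1.closedValue hV).2 ((pr L K h).2.closedValue hW).2).bigStep), bindLet_eq]
  refine bind_congr fun c _ => ?_
  cases c <;> simp [splitVal]

theorem ClosedValue.sem_app {f V : Term} {a b : Ty} (hf : ClosedValue A f (A.arrow a b))
    (hV : ClosedValue A V a) : sem (.app f V) = AffineLambda.applyVal f V := by
  simp [hf.2.sem_app hV.2, sem_value hf.1, sem_value hV.1]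

theorem ClosedValue.sem_letp {f N : Term} {a b c : Ty} (hf : ClosedValue A f (A.tensor a b))
    (hN : Typed A ((Ctx.empty.cons b).cons a) N c) :
    sem (.letp f N) = splitVal f fun V W => sem (N.inst₂ V W) := by
  simp [hf.2.sem_letp hN, sem_value hf.1]

theorem Typed.sem_letp_pair {L K N : Term} {a b c : Ty} (hL : Typed A Ctx.empty L a)
    (hK : Typed A Ctx.empty K b) (hN : Typed A ((Ctx.empty.cons b).cons a) N c) :
    sem (.letp (.pair L K) N) = bind (sem L) fun V => bind (sem K) fun W => sem (N.inst₂ V W) :=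
  ClosedValue.sem_letp ⟨trivial, .pair Ctx.Split.empty hL hK⟩ hN

end Semantics

/-! ## Evaluation of open terms -/

section Evaluation

variable {Ty : Type*} {A : TypeAlgebra Ty}

/-- Elementary evaluation contexts. The components of a pair are evaluated only when it is the head
of a `let`. -/
inductive Frame : Type
  | appL (N : Term)
  | appR (M : Term)
  | letp (N : Term)
  | pairL (K N : Term)
  | pairR (L N : Term)

namespace Frame

/-- The term obtained by filling the hole. -/
def plug : Frame → Term → Term
  | appL N, M => .app M N
  | appR M, N => .app M N
  | letp N, M => .letp M N
  | pairL K N, L => .letp (.pair L K) N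
  | pairR L N, K => .letp (.pair L K) N

/-- Substitution in a frame. -/
def subst (s : ℕ → Term) : Frame → Frame
  | appL N => appL (N.subst s)
  | appR M => appR (M.subst s)
  | letp N => letp (N.subst (liftSub (liftSub s)))
  | pairL K N => pairL (K.subst s) (N.subst (liftSub (liftSub s)))
  | pairR L N => pairR (L.subst s) (N.subst (liftSub (liftSub s)))

theorem plug_subst (F : Frame) (M : Term) (s : ℕ → Term) :
    (F.plug M).subst s = (F.subst s).plug (M.subst s) := by
  cases F <;> rfl

theorem size_plug_lt (F : Frame) {M M' : Term} (h : M.size < M'.size) :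
    (F.plug M).size < (F.plug M').size := by
  cases F <;> simp only [plug, size] <;> omega

/-- `F.Typed A Θ a b`: in the context `Θ`, the frame `F` turns a term of type `a` into one of
type `b`. -/
inductive Typed (A : TypeAlgebra Ty) : Ctx Ty → Frame → Ty → Ty → Prop
  | appL {Θ : Ctx Ty} {N : Term} {a b : Ty} (hN : AffineLambda.Typed A Θ N a) :
      Typed A Θ (appL N) (A.arrow a b) b
  | appR {Θ : Ctx Ty} {M : Term} {a b : Ty} (hM : AffineLambda.Typed A Θ M (A.arrow a b)) :
      Typed A Θ (appR M) a b
  | letp {Θ : Ctx Ty} {N : Term} {a b c : Ty}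
      (hN : AffineLambda.Typed A ((Θ.cons b).cons a) N c) :
      Typed A Θ (letp N) (A.tensor a b) c
  | pairL {Θ Θ₁ Θ₂ : Ctx Ty} {K N : Term} {a b c : Ty} (hs : Θ.Split Θ₁ Θ₂)
      (hK : AffineLambda.Typed A Θ₁ K b) (hN : AffineLambda.Typed A ((Θ₂.cons b).cons a) N c) :
      Typed A Θ (pairL K N) a c
  | pairR {Θ Θ₁ Θ₂ : Ctx Ty} {L N : Term} {a b c : Ty} (hs : Θ.Split Θ₁ Θ₂)
      (hL : AffineLambda.Typed A Θ₁ L a) (hN : AffineLambda.Typed A ((Θ₂.cons b).cons a) N c) :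
      Typed A Θ (pairR L N) b c

theorem Typed.plug {Γ Δ Θ : Ctx Ty} {F : Frame} {M : Term} {a b : Ty} (hF : F.Typed A Θ a b)
    (hs : Γ.Split Δ Θ) (hM : AffineLambda.Typed A Δ M a) : AffineLambda.Typed A Γ (F.plug M) b := by
  cases hF with
  | appL hN => exact .app hs hM hN
  | appR hN => exact .app hs.symm hN hM
  | letp hN => exact .letp hs hM hN
  | pairL hs' hK hN =>
    obtain ⟨Ξ, h₁, h₂⟩ := hs.assoc' hs'
    exact .letp h₁ (.pair h₂ hM hK) hN
  | pairR hs' hL hN =>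
    obtain ⟨Ξ, h₁, h₂⟩ := hs.assoc' hs'
    exact .letp h₁ (.pair h₂.symm hL hM) hN

theorem Typed.subst_congr {Θ : Ctx Ty} {F : Frame} {a b : Ty} (hF : F.Typed A Θ a b)
    {s t : ℕ → Term} (h : ∀ k c, Θ k = some c → s k = t k) : F.subst s = F.subst t := by
  cases hF with
  | appL hN => exact congrArg _ (hN.subst_congr h)
  | appR hN => exact congrArg _ (hN.subst_congr h)
  | letp hN => exact congrArg _ (hN.subst_congr (liftSub_congr _ (liftSub_congr _ h)))
  | pairL hs hK hN =>
    exact congrArg₂ Frame.pairL (hK.subst_congr fun k c hk => h k c (hs.left hk))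
      (hN.subst_congr (liftSub_congr _ (liftSub_congr _ fun k c hk => h k c (hs.right hk))))
  | pairR hs hK hN =>
    exact congrArg₂ Frame.pairR (hK.subst_congr fun k c hk => h k c (hs.left hk))
      (hN.subst_congr (liftSub_congr _ (liftSub_congr _ fun k c hk => h k c (hs.right hk))))

end Frame

theorem Typed.subst_liftSub_closes {Θ : Ctx Ty} {N : Term} {a b c : Ty} {V : ℕ → Term}
    (hN : Typed A ((Θ.cons b).cons a) N c) (hV : Closes A Θ V) :
    Typed A ((Ctx.empty.cons b).cons a) (N.subst (liftSub (liftSub V))) c := by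
  refine hN.subst id fun k d hk => ?_
  rcases k with _ | _ | k
  · exact .var hk
  · exact .var hk
  · have := (hV k d hk).2
    exact (this.rename (Δ := Ctx.empty) (r := Nat.succ) id fun _ _ h => nomatch h).rename
      id fun _ _ h => nomatch h

namespace Frame

theorem Typed.subst_closes {Θ : Ctx Ty} {F : Frame} {a b : Ty} {V : ℕ → Term}
    (hF : F.Typed A Θ a b) (hV : Closes A Θ V) : (F.subst V).Typed A Ctx.empty a b := by
  cases hF with
  | appL hN => exact .appL (hN.subst_closes hV)
  | appR hN => exact .appR (hN.subst_closes hV)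
  | letp hN => exact .letp (hN.subst_liftSub_closes hV)
  | pairL hs hK hN =>
    exact .pairL Ctx.Split.empty (hK.subst_closes (hV.left hs))
      (hN.subst_liftSub_closes (hV.right hs))
  | pairR hs hK hN =>
    exact .pairR Ctx.Split.empty (hK.subst_closes (hV.left hs))
      (hN.subst_liftSub_closes (hV.right hs))

/-- The term in the hole can be evaluated first, because re-evaluating a value is trivial and the
other subterms are evaluated independently. -/
theorem Typed.sem_plug {F : Frame} {M : Term} {a b : Ty} (hF : F.Typed A Ctx.empty a b)
    (hM : AffineLambda.Typed A Ctx.empty M a) :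
    sem (F.plug M) = bind (sem M) fun U => sem (F.plug U) := by
  cases hF with
  | appL hN =>
    refine (hM.sem_app hN).trans (bind_congr fun U hU => ?_)
    have hU := hM.closedValue hU
    exact .symm ((hU.2.sem_app hN).trans (by simp [sem_value hU.1]))
  | appR hN =>
    refine (hN.sem_app hM).trans ((bind_comm _ _ _).trans (bind_congr fun U hU => ?_))
    have hU := hM.closedValue hU
    exact .symm ((hN.sem_app hU.2).trans (by simp [sem_value hU.1]))
  | letp hN =>
    refine (hM.sem_letp hN).trans (bind_congr fun U hU => ?_)
    exact ((hM.closedValue hU).sem_letp hN).symm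
  | pairL hs hK hN =>
    obtain ⟨rfl, rfl⟩ := hs.eq_empty
    refine (hM.sem_letp_pair hK hN).trans (bind_congr fun U hU => ?_)
    have hU := hM.closedValue hU
    exact .symm ((hU.2.sem_letp_pair hK hN).trans (by simp [sem_value hU.1]))
  | pairR hs hL hN =>
    obtain ⟨rfl, rfl⟩ := hs.eq_empty
    refine (hL.sem_letp_pair hM hN).trans ((bind_comm _ _ _).trans (bind_congr fun U hU => ?_))
    have hU := hM.closedValue hU
    exact .symm ((hL.sem_letp_pair hU.2 hN).trans (by simp [sem_value hU.1]))

end Frame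

theorem Ctx.Split.update {Γ Δ Θ : Ctx Ty} (hs : Γ.Split Δ Θ) {i : ℕ} (hi : Θ i = none)
    (x : Option Ty) : Ctx.Split (Function.update Γ i x) (Function.update Δ i x) Θ := by
  intro k
  by_cases e : k = i
  · subst e
    simp [hi]
  · simpa [Function.update_of_ne e] using hs k

/-- How the evaluation of an open term `C` starts, uniformly in the values substituted for its
variables: it is stuck, or makes a choice (a deterministic step is a choice between equals), or
applies the variable `i` to the open value `X`, or splits the variable `i`. The result of an
application is again called `i`, the components of a pair are called `i` and `m`. -/
inductive Progress (A : TypeAlgebra Ty) (Γ : Ctx Ty) (m : ℕ) (C : Term) (c : Ty) : Prop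
  | zero (h : ∀ V, Closes A Γ V → sem (C.subst V) = 0)
  | mix {C₁ C₂ : Term} (h₁ : Typed A Γ C₁ c) (h₂ : Typed A Γ C₂ c) (s₁ : C₁.size < C.size)
      (s₂ : C₂.size < C.size)
      (h : ∀ V, Closes A Γ V →
        sem (C.subst V) = (1 / 2 : ℝ) • sem (C₁.subst V) + (1 / 2 : ℝ) • sem (C₂.subst V))
  | app {i : ℕ} {Δ Θ : Ctx Ty} {a b : Ty} {X C' : Term} (hs : Γ.Split Δ Θ)
      (hi : Δ i = some (A.arrow a b)) (oX : X.IsOpenValue) (hX : Typed A Θ X a)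
      (h' : Typed A (Function.update Δ i (some b)) C' c) (s' : C'.size < C.size)
      (h : ∀ V, Closes A Γ V → sem (C.subst V) =
        bind (applyVal (V i) (X.subst V)) fun W => sem (C'.subst (Function.update V i W)))
  | split {i : ℕ} {a b : Ty} {C' : Term} (hi : Γ i = some (A.tensor a b))
      (h' : Typed A (Function.update (Function.update Γ i (some a)) m (some b)) C' c)
      (s' : C'.size < C.size)
      (h : ∀ V, Closes A Γ V → sem (C.subst V) = splitVal (V i) fun X Y =>
        sem (C'.subst (Function.update (Function.update V i X) m Y)))

/-- A first step of `M` is a first step of `F[M]`. Variable `i` is declared in `Δ` and `m` is fresh,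
so neither occurs in the context of the frame; updating them leaves the frame unchanged. -/
theorem Progress.plug {Γ Δ Θ : Ctx Ty} {m : ℕ} {F : Frame} {M : Term} {a b : Ty}
    (h : Progress A Δ m M a) (hF : F.Typed A Θ a b) (hs : Γ.Split Δ Θ)
    (hM : Typed A Δ M a) (hm : Γ m = none) : Progress A Γ m (F.plug M) b := by
  have sem_plug : ∀ {V : ℕ → Term}, Closes A Γ V → sem ((F.plug M).subst V) =
      bind (sem (M.subst V)) fun U => sem ((F.subst V).plug U) := by
    intro V hV
    rw [Frame.plug_subst]
    exact (hF.subst_closes (hV.right hs)).sem_plug (hM.subst_closes (hV.left hs))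
  have sem_plug' : ∀ {V V' : ℕ → Term} {M' : Term} {Δ' : Ctx Ty}, Closes A Γ V →
      (∀ k c, Θ k = some c → V' k = V k) → Typed A Δ' M' a → Closes A Δ' V' →
      sem ((F.plug M').subst V') =
        bind (sem (M'.subst V')) fun U => sem ((F.subst V).plug U) := by
    intro V V' M' Δ' hV hV' hM' hc
    rw [Frame.plug_subst, hF.subst_congr hV']
    exact (hF.subst_closes (hV.right hs)).sem_plug (hM'.subst_closes hc)
  cases h with
  | zero h =>
    refine .zero fun V hV => ?_
    rw [sem_plug hV, h V (hV.left hs), bind_zero]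
  | mix h₁ h₂ s₁ s₂ h =>
    refine .mix (hF.plug hs h₁) (hF.plug hs h₂) (F.size_plug_lt s₁) (F.size_plug_lt s₂)
      fun V hV => ?_
    rw [sem_plug hV, h V (hV.left hs), bind_add, bind_smul, bind_smul,
      sem_plug' hV (fun _ _ _ => rfl) h₁ (hV.left hs),
      sem_plug' hV (fun _ _ _ => rfl) h₂ (hV.left hs)]
  | @app i Δ' Θ' d e X M' hs' hi oX hX h' s' h =>
    -- Regroup so that the variables of the argument stand alone and the rest `Ξ` serves the
    -- residual term together with the frame.
    obtain ⟨Ξ, h₁, h₂⟩ := hs.assoc hs'.symm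
    have hΘ : Θ i = none := hs.right_none (hs'.left hi)
    refine .app h₁.symm (h₂.left hi) oX hX (hF.plug (h₂.update hΘ _) h') (F.size_plug_lt s')
      fun V hV => ?_
    have hV' := (hV.left hs).left hs'
    rw [sem_plug hV, h V (hV.left hs), bind_bind]
    refine bind_congr fun W hW => (sem_plug' hV (fun k c hk => ?_) h' (hV'.update i ?_)).symm
    · exact Function.update_of_ne (fun e => by simp [e, hΘ] at hk) _ _
    · have hX' := (hV.left hs).right hs'
      exact (hV' i _ hi).applyVal ⟨hX.isValue_subst oX hX', hX.subst_closes hX'⟩ hW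
  | @split i d e M' hi h' s' h =>
    have hΘ : Θ i = none := hs.right_none hi
    have hΘm : Θ m = none := hs.symm.left_none hm
    refine .split (hs.left hi) (hF.plug ((hs.update hΘ _).update hΘm _) h') (F.size_plug_lt s')
      fun V hV => ?_
    rw [sem_plug hV, h V (hV.left hs), bind_splitVal]
    refine (hV i _ (hs.left hi)).splitVal_congr fun X Y hX hY =>
      (sem_plug' hV (fun k c hk => ?_) h' (((hV.left hs).update i hX).update m hY)).symm
    rw [Function.update_of_ne fun e => by simp [e, hΘm] at hk,
      Function.update_of_ne fun e => by simp [e, hΘ] at hk]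

theorem Progress.internal {Γ : Ctx Ty} {m : ℕ} {C C' : Term} {c : Ty} (h' : Typed A Γ C' c)
    (s' : C'.size < C.size) (h : ∀ V, Closes A Γ V → sem (C.subst V) = sem (C'.subst V)) :
    Progress A Γ m C c :=
  .mix h' h' s' s' fun V hV => by rw [h V hV, ← add_smul]; norm_num

theorem Typed.progress_app {Γ Δ Θ : Ctx Ty} {m : ℕ} {M N : Term} {a b : Ty} (hs : Γ.Split Δ Θ)
    (hM : Typed A Δ M (A.arrow a b)) (hN : Typed A Θ N a) (oM : M.IsOpenValue)
    (oN : N.IsOpenValue) : Progress A Γ m (.app M N) b := by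
  have hsem : ∀ V, Closes A Γ V → sem ((Term.app M N).subst V) =
      applyVal (M.subst V) (N.subst V) := fun V hV => ClosedValue.sem_app
    ⟨hM.isValue_subst oM (hV.left hs), hM.subst_closes (hV.left hs)⟩
    ⟨hN.isValue_subst oN (hV.right hs), hN.subst_closes (hV.right hs)⟩
  cases M with
  | var i =>
    cases hM with
    | var hi =>
      -- The whole term is the application, so what remains is its result, again called `i`.
      refine .app (C' := .var i) hs hi oN hN (.var (by simp)) (by simp [size]) fun V hV => ?_
      rw [hsem V hV]
      have hX' := hV.right hs
      have : ∀ W ∈ (applyVal (V i) (N.subst V)).support, ClosedValue A W b := fun W hW =>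
        (hV i _ (hs.left hi)).applyVal ⟨hN.isValue_subst oN hX', hN.subst_closes hX'⟩ hW
      have e : bind (applyVal (V i) (N.subst V)) (fun W => Finsupp.single W (1 : ℝ)) =
          applyVal (V i) (N.subst V) := by
        rw [bind_eq_sum]
        simp
      refine (e.symm.trans (bind_congr fun W hW => ?_) :)
      simp only [Term.subst, Function.update_self]
      exact (sem_value (this W hW).1).symm
  | lam L =>
    refine .internal (.inst hs hM.lam_inv hN) ?_ fun V hV => ?_
    · have := hM.lam_inv.size_inst_le N
      simp only [size]
      omega
    · rw [hsem V hV, inst_subst]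
      simp only [Term.subst, applyVal, subst_liftSub_inst]
  | pair L K => exact .zero fun V hV => hsem V hV
  | app | choice | omega | letp => exact oM.elim

theorem Typed.progress_letp {Γ Δ Θ : Ctx Ty} {m : ℕ} {M N : Term} {a b c : Ty}
    (hs : Γ.Split Δ Θ) (hM : Typed A Δ M (A.tensor a b)) (hN : Typed A ((Θ.cons b).cons a) N c)
    (oM : M.IsOpenValue) (hp : ∀ L K, M = .pair L K → L.IsOpenValue ∧ K.IsOpenValue)
    (hm : Γ m = none) : Progress A Γ m (.letp M N) c := by
  have hsem : ∀ V, Closes A Γ V → sem ((Term.letp M N).subst V) =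
      splitVal (M.subst V) fun X Y => sem (N.subst (scons X (scons Y V))) := by
    intro V hV
    refine (ClosedValue.sem_letp ⟨hM.isValue_subst oM (hV.left hs), hM.subst_closes (hV.left hs)⟩
      (hN.subst_liftSub_closes (hV.right hs))).trans ?_
    simp only [subst_liftSub_inst₂]
  cases M with
  | var i =>
    cases hM with
    | var hi =>
      have hΘ : Θ i = none := hs.right_none hi
      have hΘm : Θ m = none := hs.symm.left_none hm
      have him : i ≠ m := fun e => by simp [← e, hs.left hi] at hm
      refine .split (C' := N.inst₂ (.var i) (.var m)) (hs.left hi) ?_ ?_ fun V hV => ?_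
      -- Outside `Θ`, the first component receives only `i` and the second everything else,
      -- including `m`; surplus variables are harmless by weakening.
      · refine .inst₂ (Δ := fun k => if Θ k = none then
            Function.update (Function.update Γ i (some a)) m (some b) k else none)
          (Δ₁ := Function.update Ctx.empty i (some a))
          (Δ₂ := fun k => if Θ k = none ∧ k ≠ i then
            Function.update (Function.update Γ i (some a)) m (some b) k else none)
          (fun k => ?_) (fun k => ?_) hN (.var (by simp)) (.var ?_)
        · by_cases hk : Θ k = none
          · exact .inl (by simp [hk])
          · obtain ⟨d, hd⟩ := Option.ne_none_iff_exists'.1 hk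
            refine .inr ⟨by simp [hk], ?_⟩
            rw [Function.update_of_ne fun e => by simp [e, hΘm] at hd,
              Function.update_of_ne fun e => by simp [e, hΘ] at hd, hd, hs.right hd]
        · by_cases hk : k = i
          · subst hk
            simp [hΘ, him]
          · exact .inr (by simp [hk, Ctx.empty])
        · simp [hΘm, him.symm]
      · have := hN.size_inst₂_le (.var i) (.var m)
        simp only [size] at this ⊢
        omega
      · rw [hsem V hV]
        refine (hV i _ (hs.left hi)).splitVal_congr fun X Y hX hY => ?_
        rw [inst₂_subst]
        congr 1
        refine hN.subst_congr fun k d hk => ?_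
        rcases k with _ | _ | k
        · simp [scons, Term.subst, him]
        · simp [scons, Term.subst]
        · have hk : Θ k = some d := hk
          simp only [scons]
          rw [Function.update_of_ne fun e => by simp [e, hΘm] at hk,
            Function.update_of_ne fun e => by simp [e, hΘ] at hk]
  | lam L => exact .zero fun V hV => hsem V hV
  | pair L K =>
    obtain ⟨oL, oK⟩ := hp L K rfl
    obtain ⟨Δ₁, Δ₂, hs', hL, hK⟩ := hM.pair_inv
    refine .internal (.inst₂ hs hs' hN hL hK) ?_ fun V hV => ?_
    · have := hN.size_inst₂_le L K
      simp only [size]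
      omega
    · have hV' := hV.left hs
      rw [hsem V hV, inst₂_subst]
      simp [Term.subst, splitVal, sem_value (hL.isValue_subst oL (hV'.left hs')),
        sem_value (hK.isValue_subst oK (hV'.right hs'))]
  | app | choice | omega | letp => exact oM.elim

/-- Locate the next redex: if some subterm due for evaluation is not yet an open value, recurse into
it and use `Progress.plug`; otherwise the root itself steps or is stuck. -/
theorem Typed.progress {Γ : Ctx Ty} {m : ℕ} {C : Term} {c : Ty} (h : Typed A Γ C c)
    (hC : ¬ C.IsOpenValue) (hm : Γ m = none) : Progress A Γ m C c := by
  induction n : C.size using Nat.strong_induction_on generalizing Γ C c with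
  | _ n ih =>
  subst n
  cases h with
  | var | lam | pair => exact (hC trivial).elim
  | omega => exact .zero fun V _ => sem_omega
  | choice hM hN =>
    exact .mix hM hN (by simp only [size]; omega) (by simp only [size]; omega) fun V hV =>
      (hM.subst_closes hV).sem_choice (hN.subst_closes hV)
  | @app _ Δ Θ M N a _ hs hM hN =>
    by_cases oM : M.IsOpenValue
    · by_cases oN : N.IsOpenValue
      · exact Typed.progress_app hs hM hN oM oN
      · exact (ih _ (by simp only [size]; omega) hN oN (hs.symm.left_none hm) rfl).plug
          (.appR hM) hs.symm hN hm
    · exact (ih _ (by simp only [size]; omega) hM oM (hs.left_none hm) rfl).plug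
        (.appL hN) hs hM hm
  | @letp _ Δ Θ M N a b _ hs hM hN =>
    by_cases oM : M.IsOpenValue
    -- A pair is already a value, but `let` evaluates its components before substituting them, so
    -- they must be reduced first.
    · by_cases hp : ∀ L K, M = .pair L K → L.IsOpenValue ∧ K.IsOpenValue
      · exact Typed.progress_letp hs hM hN oM hp hm
      · push Not at hp
        obtain ⟨L, K, rfl, hLK⟩ := hp
        obtain ⟨Δ₁, Δ₂, hs', hL, hK⟩ := hM.pair_inv
        by_cases oL : L.IsOpenValue
        · obtain ⟨Ξ, h₁, h₂⟩ := hs.assoc hs'.symm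
          exact (ih _ (by simp only [size]; omega) hK (hLK oL)
            (h₁.left_none hm) rfl).plug (.pairR h₂ hL hN) h₁ hK hm
        · obtain ⟨Ξ, h₁, h₂⟩ := hs.assoc hs'
          exact (ih _ (by simp only [size]; omega) hL oL
            (h₁.left_none hm) rfl).plug (.pairL h₂ hK hN) h₁ hL hm
    · exact (ih _ (by simp only [size]; omega) hM oM (hs.left_none hm) rfl).plug
        (.letp hN) hs hM hm

end Evaluation

/-! ## Positions in tuples -/

section Lists

variable {α β : Type*}

theorem forall₂_set {R : α → β → Prop} {l : List α} {l' : List β} (h : List.Forall₂ R l l')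
    (i : ℕ) {x : α} {y : β} (hxy : R x y) : List.Forall₂ R (l.set i x) (l'.set i y) := by
  induction h generalizing i with
  | nil => exact .nil
  | cons h t ih =>
    cases i with
    | zero => exact .cons hxy t
    | succ i => exact .cons h (ih i)

theorem exists_getElem?_of_forall₂ {R : α → β → Prop} {l : List α} {l' : List β}
    (h : List.Forall₂ R l l') {i : ℕ} {y : β} (hy : l'[i]? = some y) :
    ∃ x, l[i]? = some x ∧ R x y := by
  induction h generalizing i with
  | nil => simp at hy
  | cons h t ih =>
    cases i with
    | zero => exact ⟨_, rfl, by simpa using (show _ = y by simpa using hy) ▸ h⟩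
    | succ i => exact ih (by simpa using hy)

theorem forall₂_splitAt {R : α → β → Prop} {l : List α} {l' : List β} (h : List.Forall₂ R l l')
    (i : ℕ) {x x' : α} {y y' : β} (hx : R x y) (hx' : R x' y') :
    List.Forall₂ R (splitAt l i x x') (splitAt l' i y y') :=
  List.rel_append (List.forall₂_take i h) (.cons hx (.cons hx' (List.forall₂_drop (i + 1) h)))

theorem forall₂_removeAt {R : α → β → Prop} {l : List α} {l' : List β} (h : List.Forall₂ R l l')
    (J : Finset ℕ) : List.Forall₂ R (removeAt l J) (removeAt l' J) := by
  have key : ∀ n, List.Forall₂ R (((l.zipIdx n).filter fun p => p.2 ∉ J).map Prod.fst)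
      (((l'.zipIdx n).filter fun p => p.2 ∉ J).map Prod.fst) := by
    induction h with
    | nil => intro n; exact .nil
    | cons h t ih =>
      intro n
      by_cases hn : n ∈ J
      · simpa [hn] using ih (n + 1)
      · simpa [hn, h] using ih (n + 1)
  exact key 0

/-- The position that the entry in position `j` takes when the entries in the positions in `J` are
removed. -/
def shiftPos (J : Finset ℕ) (j : ℕ) : ℕ := (Finset.range j \ J).card

theorem getElem?_removeAt (l : List α) {J : Finset ℕ} {j : ℕ} (hj : j ∉ J) :
    (removeAt l J)[shiftPos J j]? = l[j]? := by
  -- The induction on the list needs an arbitrary starting index for `zipIdx`; surviving positions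
  -- are then counted in `[n, j)`.
  have key : ∀ n, n ≤ j →
      (((l.zipIdx n).filter fun p => p.2 ∉ J).map Prod.fst)[(Finset.Ico n j \ J).card]? =
        l[j - n]? := by
    induction l with
    | nil => intro n _; simp
    | cons x l ih =>
      intro n hn
      rcases hn.eq_or_lt with rfl | hn
      · simp [hj]
      · have e : j - n = (j - (n + 1)) + 1 := by omega
        have e' : Finset.Ico n j = insert n (Finset.Ico (n + 1) j) :=
          (Finset.insert_Ico_add_one_left_eq_Ico hn).symm
        have h := ih (n + 1) hn
        by_cases hJ : n ∈ J
        · rw [e', Finset.insert_sdiff_of_mem _ hJ, e, List.getElem?_cons_succ, ← h]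
          simp [hJ]
        · rw [e', Finset.insert_sdiff_of_notMem _ hJ, Finset.card_insert_of_notMem (by simp), e,
            List.getElem?_cons_succ, ← h]
          simp [hJ]
  have := key 0 (Nat.zero_le _)
  rwa [← Finset.range_eq_Ico] at this

theorem shiftPos_injOn {J : Finset ℕ} {j k : ℕ} (hj : j ∉ J) (hk : k ∉ J)
    (h : shiftPos J j = shiftPos J k) : j = k := by
  have key : ∀ {j k : ℕ}, j ∉ J → j < k → shiftPos J j < shiftPos J k := by
    intro j k hj hlt
    refine Finset.card_lt_card (Finset.ssubset_iff_subset_ne.2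
      ⟨Finset.sdiff_subset_sdiff (Finset.range_subset_range.2 hlt.le) le_rfl, fun e => ?_⟩)
    have : j ∈ Finset.range k \ J := by simp [hj, hlt]
    simp [← e] at this
  rcases lt_trichotomy j k with hlt | rfl | hlt
  · exact absurd h (key hj hlt).ne
  · rfl
  · exact absurd h (key hk hlt).ne'

/-- The first component keeps position `i`; later entries move by one to make room for the second.
-/
theorem getElem?_splitAt (l : List α) {i : ℕ} (hi : i < l.length) (x y : α) (j : ℕ) :
    (splitAt l i x y)[if j ≤ i then j else j + 1]? = (l.set i x)[j]? := by
  have hl : (l.take i).length = i := by simp [hi.le]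
  unfold splitAt
  rcases lt_trichotomy j i with h | rfl | h
  · rw [if_pos h.le, List.getElem?_append_left (by omega), List.getElem?_take_of_lt h,
      List.getElem?_set_ne (by omega)]
  · rw [if_pos le_rfl, List.getElem?_append_right (by omega), hl]
    simp [hi]
  · obtain ⟨k, rfl⟩ := Nat.exists_eq_add_of_lt h
    rw [if_neg (by omega), List.getElem?_append_right (by omega), hl,
      List.getElem?_set_ne (by omega), show i + k + 1 + 1 - i = k + 1 + 1 by omega]
    simp only [List.getElem?_cons_succ, List.getElem?_drop]
    congr 1
    omega

theorem getElem?_splitAt_succ (l : List α) {i : ℕ} (hi : i < l.length) (x y : α) :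
    (splitAt l i x y)[i + 1]? = some y := by
  have hl : (l.take i).length = i := by simp [hi.le]
  unfold splitAt
  rw [List.getElem?_append_right (by omega), hl]
  simp

end Lists

/-! ## The tuple Markov chain -/

theorem tupleStep_split {K : List Term} {i : ℕ} {V : Term} (h : K[i]? = some V) :
    tupleStep K (.split i) =
      splitVal V fun X Y => Finsupp.single (splitAt K i X Y) (1 : ℝ) := by
  cases V <;> simp [tupleStep, h, splitVal, bind_eq_sum, Finsupp.smul_sum]

theorem tupleStep_apply {K : List Term} {i : ℕ} {V : Term} (h : K[i]? = some V) (J : Finset ℕ)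
    (C : Term) : tupleStep K (.apply i J C) =
      bind (applyVal V (C.subst fun j => K.getD j .omega)) fun W =>
        Finsupp.single (removeAt (K.set i W) J) (1 : ℝ) := by
  cases V <;> simp [tupleStep, h, applyVal, bind_eq_sum]

theorem isSubdist_tupleStep (K : List Term) (a : TupleAct) : IsSubdist (tupleStep K a) := by
  cases a with
  | split i =>
    cases h : K[i]? with
    | none => simp only [tupleStep, h]; exact .zero
    | some V =>
      rw [tupleStep_split h]
      exact isSubdist_splitVal _ fun _ _ => .single _
  | apply i J C =>
    cases h : K[i]? with
    | none => simp only [tupleStep, h]; exact .zero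
    | some V =>
      rw [tupleStep_apply h]
      exact (isSubdist_applyVal _ _).bind fun _ _ => .single _

theorem tupleProb_cons (a : TupleAct) (s : List TupleAct) (K : List Term) :
    tupleProb (a :: s) K = bind (tupleStep K a) (tupleProb s) := rfl

theorem tupleProb_mem (s : List TupleAct) (K : List Term) :
    tupleProb s K ∈ Set.Icc (0 : ℝ) 1 := by
  induction s generalizing K with
  | nil => exact ⟨zero_le_one, le_rfl⟩
  | cons a s ih =>
    rw [tupleProb_cons]
    exact (isSubdist_tupleStep K a).bind_mem fun H _ => ih H

section Tuples

variable {Ty : Type*} {A : TypeAlgebra Ty}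

theorem abs_tupleProb_sub_le_tupleDist {T : List Ty} {s : List TupleAct}
    (hs : TupleTraceTyped A T s) (K H : List Term) :
    |tupleProb s K - tupleProb s H| ≤ tupleDist A T K H := by
  -- The bound 1 holds because both probabilities lie in [0,1].
  refine le_csSup ⟨1, ?_⟩ ⟨s, hs, rfl⟩
  rintro d ⟨s, -, rfl⟩
  have hK := tupleProb_mem s K
  have hH := tupleProb_mem s H
  rw [abs_le]
  constructor <;> linarith [hK.1, hK.2, hH.1, hH.2]

/-- Tuples of closed values of the given types. -/
abbrev TypedTuple (A : TypeAlgebra Ty) : List Term → List Ty → Prop :=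
  List.Forall₂ (ClosedValue A)

/-- On tuples with the types `T`, the function `f` is a subconvex combination of the acceptance
probabilities of tuple traces. -/
def Testable (A : TypeAlgebra Ty) (T : List Ty) (f : List Term → ℝ) : Prop :=
  ∃ l : List (ℝ × List TupleAct), (∀ x ∈ l, 0 ≤ x.1 ∧ TupleTraceTyped A T x.2) ∧
    (l.map Prod.fst).sum ≤ 1 ∧
    ∀ K, TypedTuple A K T → f K = (l.map fun x => x.1 * tupleProb x.2 K).sum

namespace Testable

variable {T : List Ty} {f g : List Term → ℝ}

theorem congr (hf : Testable A T f) (h : ∀ K, TypedTuple A K T → g K = f K) : Testable A T g := by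
  obtain ⟨l, h₁, h₂, h₃⟩ := hf
  exact ⟨l, h₁, h₂, fun K hK => (h K hK).trans (h₃ K hK)⟩

theorem zero : Testable A T fun _ => 0 := ⟨[], by simp, by simp, by simp⟩

theorem one : Testable A T fun _ => 1 :=
  ⟨[(1, [])], by simp [TupleTraceTyped.nil], by simp, by simp [tupleProb]⟩

theorem mix (hf : Testable A T f) (hg : Testable A T g) :
    Testable A T fun K => (1 / 2 : ℝ) * f K + (1 / 2 : ℝ) * g K := by
  obtain ⟨l, h₁, h₂, h₃⟩ := hf
  obtain ⟨l', h₁', h₂', h₃'⟩ := hg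
  have map_sum : ∀ (l : List (ℝ × List TupleAct)) (u : ℝ × List TupleAct → ℝ),
      (l.map fun x => (1 / 2 : ℝ) * u x).sum = (1 / 2 : ℝ) * (l.map u).sum :=
    fun l u => List.sum_map_mul_left l u _
  refine ⟨l.map (fun x => (1 / 2 * x.1, x.2)) ++ l'.map fun x => (1 / 2 * x.1, x.2),
    fun x hx => ?_, ?_, fun K hK => ?_⟩
  · simp only [List.mem_append, List.mem_map] at hx
    rcases hx with ⟨y, hy, rfl⟩ | ⟨y, hy, rfl⟩
    · exact ⟨mul_nonneg (by norm_num) (h₁ y hy).1, (h₁ y hy).2⟩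
    · exact ⟨mul_nonneg (by norm_num) (h₁' y hy).1, (h₁' y hy).2⟩
  · simp only [List.map_append, List.map_map, Function.comp_def, List.sum_append]
    rw [map_sum l, map_sum l']
    linarith
  · simp only [List.map_append, List.map_map, Function.comp_def, List.sum_append, mul_assoc]
    rw [map_sum l, map_sum l', h₃ K hK, h₃' K hK]

/-- Prefixing every trace of the combination by `a` keeps the weights, since averaging over a
transition is linear. -/
theorem act {T' : List Ty} {a : TupleAct} (hf : Testable A T' f)
    (ha : ∀ s, TupleTraceTyped A T' s → TupleTraceTyped A T (a :: s))
    (hT : ∀ K, TypedTuple A K T → ∀ H ∈ (tupleStep K a).support, TypedTuple A H T') :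
    Testable A T fun K => bind (tupleStep K a) f := by
  obtain ⟨l, h₁, h₂, h₃⟩ := hf
  refine ⟨l.map fun x => (x.1, a :: x.2), fun x hx => ?_, ?_, fun K hK => ?_⟩
  · obtain ⟨y, hy, rfl⟩ := List.mem_map.1 hx
    exact ⟨(h₁ y hy).1, ha _ (h₁ y hy).2⟩
  · simpa [Function.comp_def] using h₂
  · refine (bind_congr fun H hH => h₃ H (hT K hK H hH)).trans ?_
    clear h₁ h₂ h₃
    induction l with
    | nil => simp
    | cons x l ih =>
      simp only [List.map_cons, List.sum_cons] at ih ⊢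
      rw [bind_add_right, ih, tupleProb_cons]
      congr 1
      exact bind_smul_right _ _ _

theorem abs_sub_le (hf : Testable A T f) {K H : List Term} (hK : TypedTuple A K T)
    (hH : TypedTuple A H T) : |f K - f H| ≤ tupleDist A T K H := by
  obtain ⟨l, h₁, h₂, h₃⟩ := hf
  rw [h₃ K hK, h₃ H hH]
  have h₀ : 0 ≤ tupleDist A T K H :=
    (abs_nonneg _).trans (abs_tupleProb_sub_le_tupleDist .nil K H)
  have key : |(l.map fun x => x.1 * tupleProb x.2 K).sum -
      (l.map fun x => x.1 * tupleProb x.2 H).sum| ≤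
        (l.map Prod.fst).sum * tupleDist A T K H := by
    clear h₂ h₃
    induction l with
    | nil => simp
    | cons x l ih =>
      have ih := ih fun y hy => h₁ y (List.mem_cons_of_mem _ hy)
      have hx := h₁ x List.mem_cons_self
      have := mul_le_mul_of_nonneg_left (abs_tupleProb_sub_le_tupleDist hx.2 K H) hx.1
      rw [← abs_of_nonneg hx.1, ← abs_mul, abs_of_nonneg hx.1] at this
      simp only [List.map_cons, List.sum_cons]
      rw [add_sub_add_comm, ← mul_sub, add_mul]
      exact (abs_add_le _ _).trans (add_le_add this ih)
  exact key.trans (mul_le_of_le_one_left h₀ h₂)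

end Testable

/-- The tuple with the types `T` has a component for each variable in `Γ`, in position `ρ k` for the
variable `k`. -/
structure Locates (Γ : Ctx Ty) (T : List Ty) (ρ : ℕ → ℕ) : Prop where
  get : ∀ {k a}, Γ k = some a → T[ρ k]? = some a
  inj : ∀ {k l a b}, Γ k = some a → Γ l = some b → ρ k = ρ l → k = l

/-- The substitution of the components of `K` for the variables located by `ρ`. -/
def env (K : List Term) (ρ : ℕ → ℕ) (k : ℕ) : Term := K.getD (ρ k) .omega

theorem env_eq {K : List Term} {ρ : ℕ → ℕ} {k : ℕ} {V : Term} (h : K[ρ k]? = some V) :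
    env K ρ k = V := by
  rw [env, List.getD_eq_getElem?_getD, h]; rfl

namespace Locates

variable {Γ : Ctx Ty} {T : List Ty} {ρ : ℕ → ℕ}

theorem lt (h : Locates Γ T ρ) {k : ℕ} {a : Ty} (hk : Γ k = some a) : ρ k < T.length :=
  (List.getElem?_eq_some_iff.1 (h.get hk)).1

/-- Supplies the left inverse that `Typed.rename` requires when variables are renamed to tuple
positions. -/
theorem exists_owner (h : Locates Γ T ρ) : ∃ o : ℕ → ℕ, ∀ k a, Γ k = some a → o (ρ k) = k := by
  classical
  refine ⟨fun j => if hj : ∃ k a, Γ k = some a ∧ ρ k = j then hj.choose else 0, fun k a hk => ?_⟩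
  have hj : ∃ l a, Γ l = some a ∧ ρ l = ρ k := ⟨k, a, hk, rfl⟩
  obtain ⟨b, hb, e⟩ := hj.choose_spec
  simp only [dif_pos hj]
  exact h.inj hb hk e

/-- Declared variables inject into the finitely many positions. The fresh name will denote the
second component of a split pair. -/
theorem exists_fresh (h : Locates Γ T ρ) : ∃ m, Γ m = none := by
  by_contra! hΓ
  choose a ha using fun k => Option.ne_none_iff_exists'.1 (hΓ k)
  refine not_injective_infinite_finite (fun k => (⟨ρ k, h.lt (ha k)⟩ : Fin T.length)) ?_
  intro k l e
  exact h.inj (ha k) (ha l) (Fin.ext_iff.1 e)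

theorem getElem? (h : Locates Γ T ρ) {K : List Term} (hK : TypedTuple A K T) {k : ℕ} {a : Ty}
    (hk : Γ k = some a) : K[ρ k]? = some (env K ρ k) ∧ ClosedValue A (env K ρ k) a := by
  obtain ⟨V, hV, hVa⟩ := exists_getElem?_of_forall₂ hK (h.get hk)
  rw [env_eq hV]
  exact ⟨hV, hVa⟩

theorem closes (h : Locates Γ T ρ) {K : List Term} (hK : TypedTuple A K T) :
    Closes A Γ (env K ρ) := fun _ _ hk => (h.getElem? hK hk).2

end Locates

/-! ### Traces of programs -/

theorem traceProb_eq (M : Term) (s : List Act) : traceProb M s = bind (sem M) (valueProb s) := rfl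

/-- This and `traceProb_tens` trade an action of the trace for a constructor of the term. -/
theorem ClosedValue.traceProb_app {f V : Term} {a b : Ty} (hf : ClosedValue A f (A.arrow a b))
    (hV : ClosedValue A V a) (s : List Act) :
    traceProb f (.app V :: s) = traceProb (.app f V) s := by
  rw [traceProb_value hf.1, traceProb_eq, hf.sem_app hV]
  cases f <;> simp [valueProb, AffineLambda.applyVal, bind_eq_sum]

theorem ClosedValue.traceProb_tens {f L : Term} {a b c : Ty}
    (hf : ClosedValue A f (A.tensor a b)) (hL : Typed A ((Ctx.empty.cons b).cons a) L c)
    (s : List Act) : traceProb f (.tens L :: s) = traceProb (.letp f L) s := by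
  rw [traceProb_value hf.1, traceProb_eq, hf.sem_letp hL, bind_splitVal]
  cases f <;> simp [valueProb, splitVal, bind_eq_sum, Finsupp.mul_sum, mul_assoc]

/-- The size of the terms in a trace. -/
def traceSize (s : List Act) : ℕ :=
  (s.map fun x => match x with
    | .app V => V.size + 2
    | .tens L => L.size + 2).sum

section Actions

variable {Γ Δ Θ : Ctx Ty} {T : List Ty} {ρ : ℕ → ℕ} {a b : Ty} {i m : ℕ} {X : Term}
  {f : List Term → ℝ}

/-- The symbolic application becomes one tuple action. Components for `Θ` then disappear, so `g`
must depend only on what remains, namely `Δ` with the result at `i`; this is `hg`. -/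
theorem Testable.apply (hρ : Locates Γ T ρ) (hs : Γ.Split Δ Θ) (hi : Δ i = some (A.arrow a b))
    (oX : X.IsOpenValue) (hX : Typed A Θ X a) {g : (ℕ → Term) → ℝ}
    (hg : ∀ {V V' : ℕ → Term}, (∀ k c, Function.update Δ i (some b) k = some c → V k = V' k) →
      g V = g V')
    (h : ∀ T' ρ', Locates (Function.update Δ i (some b)) T' ρ' →
      Testable A T' fun K => g (env K ρ')) :
    Testable A T fun K => bind (applyVal (env K ρ i) (X.subst (env K ρ))) fun W =>
      g (Function.update (env K ρ) i W) := by
  classical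
  -- All of `Θ` is consumed, even variables that do not occur in `X`: the tuple action is also
  -- affine and allows them.
  let J := (Finset.range T.length).filter fun j => ∃ k c, Θ k = some c ∧ ρ k = j
  have hJ : ∀ {k c}, Θ k = some c → ρ k ∈ J := fun {k c} hk => by
    simp only [J, Finset.mem_filter, Finset.mem_range]
    exact ⟨hρ.lt (hs.right hk), k, c, hk, rfl⟩
  have hJ' : ∀ {k c}, Δ k = some c → ρ k ∉ J := by
    intro k c hk hmem
    obtain ⟨-, l, d, hl, e⟩ := Finset.mem_filter.1 hmem
    obtain rfl := hρ.inj (hs.right hl) (hs.left hk) e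
    simp [hs.right_none hk] at hl
  have hΔ : ∀ {k c}, Function.update Δ i (some b) k = some c →
      (k = i ∧ b = c) ∨ (k ≠ i ∧ Δ k = some c) := by
    intro k c hk
    by_cases e : k = i
    · subst e
      exact .inl ⟨rfl, by simpa using hk⟩
    · exact .inr ⟨e, by rwa [Function.update_of_ne e] at hk⟩
  have hΔ' : ∀ {k c}, Function.update Δ i (some b) k = some c → ∃ d, Δ k = some d := by
    intro k c hk
    rcases hΔ hk with ⟨rfl, -⟩ | ⟨-, h⟩
    · exact ⟨_, hi⟩
    · exact ⟨_, h⟩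
  have hρ' : Locates (Function.update Δ i (some b)) (removeAt (T.set (ρ i) b) J)
      fun k => shiftPos J (ρ k) := by
    refine ⟨fun {k c} hk => ?_, fun {k l c d} hk hl e => ?_⟩
    · obtain ⟨d, hd⟩ := hΔ' hk
      rw [getElem?_removeAt _ (hJ' hd)]
      rcases hΔ hk with ⟨rfl, rfl⟩ | ⟨hne, hk⟩
      · simp [hρ.lt (hs.left hi)]
      · rw [List.getElem?_set_ne fun e => hne (hρ.inj (hs.left hk) (hs.left hi) e.symm)]
        exact hρ.get (hs.left hk)
    · obtain ⟨c', hk'⟩ := hΔ' hk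
      obtain ⟨d', hl'⟩ := hΔ' hl
      exact hρ.inj (hs.left hk') (hs.left hl') (shiftPos_injOn (hJ' hk') (hJ' hl') e)
  have hstep : ∀ K : List Term, TypedTuple A K T →
      tupleStep K (.apply (ρ i) J (X.rename ρ)) =
        bind (applyVal (env K ρ i) (X.subst (env K ρ))) fun W =>
          Finsupp.single (removeAt (K.set (ρ i) W) J) (1 : ℝ) := by
    intro K hK
    rw [tupleStep_apply (hρ.getElem? hK (hs.left hi)).1, rename_subst]
    rfl
  have hval : ∀ {K : List Term}, TypedTuple A K T → ∀ {W},
      W ∈ (applyVal (env K ρ i) (X.subst (env K ρ))).support → ClosedValue A W b := by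
    intro K hK W hW
    have hV := (hρ.closes hK).right hs
    exact (hρ.getElem? hK (hs.left hi)).2.applyVal
      ⟨hX.isValue_subst oX hV, hX.subst_closes hV⟩ hW
  refine ((h _ _ hρ').act (a := .apply (ρ i) J (X.rename ρ)) (fun s hs' => ?_)
    fun K hK H hH => ?_).congr fun K hK => ?_
  · obtain ⟨o, ho⟩ := hρ.exists_owner
    refine .apply (hρ.get (hs.left hi)) (fun j hj => ?_) ?_ (hX.rename o fun k c hk => ?_) hs'
    · obtain ⟨hj', l, d, hl, e⟩ := Finset.mem_filter.1 hj
      exact ⟨Finset.mem_range.1 hj', fun e' => hJ' hi (e' ▸ hj)⟩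
    · cases X <;> trivial
    · simp [Ctx.owned, Ctx.restrict, ho k c (hs.right hk), hJ hk, hρ.get (hs.right hk)]
  · rw [hstep K hK] at hH
    obtain ⟨W, hW, hH⟩ := exists_of_mem_support_bind hH
    obtain rfl : H = _ := by simpa using Finsupp.support_single_subset hH
    exact forall₂_removeAt (forall₂_set hK _ (hval hK hW)) J
  · rw [hstep K hK, bind_bind]
    refine bind_congr fun W hW => ?_
    rw [bind_single, one_smul]
    refine hg fun k c hk => ?_
    obtain ⟨d, hd⟩ := hΔ' hk
    refine (env_eq ?_).symm
    rw [getElem?_removeAt _ (hJ' hd)]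
    rcases hΔ hk with ⟨rfl, -⟩ | ⟨hne, hk⟩
    · have := (hρ.getElem? hK (hs.left hi)).1
      simp [(List.getElem?_eq_some_iff.1 this).1]
    · rw [List.getElem?_set_ne fun e => hne (hρ.inj (hs.left hk) (hs.left hi) e.symm),
        Function.update_of_ne hne]
      exact (hρ.getElem? hK (hs.left hk)).1

theorem Testable.split (hρ : Locates Γ T ρ) (hi : Γ i = some (A.tensor a b)) (hm : Γ m = none)
    {g : (ℕ → Term) → ℝ}
    (hg : ∀ {V V' : ℕ → Term}, (∀ k c, Function.update (Function.update Γ i (some a)) m (some b) k =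
      some c → V k = V' k) → g V = g V')
    (h : ∀ T' ρ', Locates (Function.update (Function.update Γ i (some a)) m (some b)) T' ρ' →
      Testable A T' fun K => g (env K ρ')) :
    Testable A T fun K => splitVal (env K ρ i) fun X Y =>
      g (Function.update (Function.update (env K ρ) i X) m Y) := by
  have him : i ≠ m := fun e => by simp [← e, hi] at hm
  have hlt := hρ.lt hi
  have hΓ : ∀ {k c}, Function.update (Function.update Γ i (some a)) m (some b) k = some c →
      (k = m ∧ b = c) ∨ (k ≠ m ∧ k = i ∧ a = c) ∨ (k ≠ m ∧ k ≠ i ∧ Γ k = some c) := by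
    intro k c hk
    by_cases e : k = m
    · subst e
      exact .inl ⟨rfl, by simpa using hk⟩
    · rw [Function.update_of_ne e] at hk
      by_cases e' : k = i
      · subst e'
        exact .inr (.inl ⟨e, rfl, by simpa using hk⟩)
      · exact .inr (.inr ⟨e, e', by rwa [Function.update_of_ne e'] at hk⟩)
  -- The fresh variable takes the slot just after the split position, which the shift of later
  -- entries leaves free.
  let ρ' := fun k => if k = m then ρ i + 1 else if ρ k ≤ ρ i then ρ k else ρ k + 1
  have hρ' : Locates (Function.update (Function.update Γ i (some a)) m (some b))
      (splitAt T (ρ i) a b) ρ' := by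
    refine ⟨fun {k c} hk => ?_, fun {k l c d} hk hl e => ?_⟩
    · rcases hΓ hk with ⟨rfl, rfl⟩ | ⟨h₁, rfl, rfl⟩ | ⟨h₁, h₂, hk⟩
      · simp only [ρ', if_pos]
        exact getElem?_splitAt_succ _ hlt _ _
      · simp only [ρ', if_neg h₁]
        rw [getElem?_splitAt _ hlt]
        simp [hlt]
      · simp only [ρ', if_neg h₁]
        rw [getElem?_splitAt _ hlt, List.getElem?_set_ne fun e => h₂ (hρ.inj hk hi e.symm)]
        exact hρ.get hk
    · have hne : ∀ {k c}, Γ k = some c → k ≠ i → ρ k ≠ ρ i := fun hk hne e =>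
        hne (hρ.inj hk hi e)
      have hfresh : ∀ k, k ≠ m → ρ' k ≠ ρ i + 1 ∨ ρ k = ρ i := by
        intro k hk
        simp only [ρ', if_neg hk]
        split <;> omega
      have hΓ' : ∀ {k c}, k ≠ m →
          Function.update (Function.update Γ i (some a)) m (some b) k = some c →
          ∃ d, Γ k = some d := by
        intro k c hkm hk
        rcases hΓ hk with ⟨rfl, -⟩ | ⟨-, rfl, -⟩ | ⟨-, -, hk⟩
        · exact (hkm rfl).elim
        · exact ⟨_, hi⟩
        · exact ⟨_, hk⟩
      by_cases hkm : k = m <;> by_cases hlm : l = m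
      · rw [hkm, hlm]
      · simp only [ρ', if_pos hkm, if_neg hlm] at e
        split at e <;> omega
      · simp only [ρ', if_neg hkm, if_pos hlm] at e
        split at e <;> omega
      · obtain ⟨c', hk'⟩ := hΓ' hkm hk
        obtain ⟨d', hl'⟩ := hΓ' hlm hl
        refine hρ.inj hk' hl' ?_
        simp only [ρ', if_neg hkm, if_neg hlm] at e
        split at e <;> split at e <;> omega
  refine ((h _ _ hρ').act (a := .split (ρ i)) (fun s hs' => .split (hρ.get hi) hs')
    fun K hK H hH => ?_).congr fun K hK => ?_
  · obtain ⟨e, hV⟩ := hρ.getElem? hK hi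
    rw [tupleStep_split e] at hH
    revert hV hH
    cases env K ρ i with
    | pair L M =>
      intro hH hV
      obtain ⟨Δ, Θ, hs, hL, hM⟩ := hV.2.pair_inv
      obtain ⟨rfl, rfl⟩ := hs.eq_empty
      obtain ⟨X, hX, hH⟩ := exists_of_mem_support_bind hH
      obtain ⟨Y, hY, hH⟩ := exists_of_mem_support_bind hH
      obtain rfl : H = _ := by simpa using Finsupp.support_single_subset hH
      exact forall₂_splitAt hK _ (hL.closedValue hX) (hM.closedValue hY)
    | _ => intro hH; simp [splitVal] at hH
  · obtain ⟨e, hV⟩ := hρ.getElem? hK hi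
    have hlt := (List.getElem?_eq_some_iff.1 e).1
    rw [tupleStep_split e, bind_splitVal]
    refine hV.splitVal_congr fun X Y hX hY => ?_
    rw [bind_single, one_smul]
    refine hg fun k c hk => (env_eq ?_).symm
    rcases hΓ hk with ⟨rfl, rfl⟩ | ⟨h₁, rfl, rfl⟩ | ⟨h₁, h₂, hk⟩
    · simp only [ρ', if_pos, Function.update_self]
      exact getElem?_splitAt_succ _ hlt _ _
    · simp only [ρ', if_neg h₁]
      rw [getElem?_splitAt _ hlt, Function.update_of_ne h₁]
      simp [hlt]
    · simp only [ρ', if_neg h₁]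
      rw [getElem?_splitAt _ hlt, List.getElem?_set_ne fun e => h₂ (hρ.inj hk hi e.symm),
        Function.update_of_ne h₁, Function.update_of_ne h₂]
      exact (hρ.getElem? hK hk).1

end Actions

/-- The probability that an instance of `C` accepts a given trace is a subconvex combination of the
probabilities that the tuple of the substituted values accepts tuple traces. -/
theorem Typed.testable_traceProb {Γ : Ctx Ty} {C : Term} {c : Ty} (hC : Typed A Γ C c)
    {s : List Act} (hs : TraceTyped A c s) {T : List Ty} {ρ : ℕ → ℕ} (hρ : Locates Γ T ρ) :
    Testable A T fun K => traceProb (C.subst (env K ρ)) s := by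
  induction n : C.size + traceSize s using Nat.strong_induction_on generalizing Γ C c s T ρ with
  | _ n ih =>
  subst n
  -- An open value waits for the trace, while any other term makes an evaluation step and keeps the
  -- trace.
  by_cases oC : C.IsOpenValue
  · have hval : ∀ K, TypedTuple A K T → ClosedValue A (C.subst (env K ρ)) c := fun K hK =>
      ⟨hC.isValue_subst oC (hρ.closes hK), hC.subst_closes (hρ.closes hK)⟩
    cases hs with
    | nil =>
      refine Testable.one.congr fun K hK => ?_
      rw [traceProb_value (hval K hK).1]
      simp [valueProb]
    | @app a b V s hV hs =>
      refine (ih _ ?_ (.app (Ctx.Split.empty_left Γ) hC hV.2) hs hρ rfl).congr fun K hK => ?_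
      -- The action weighs `V.size + 2` but the application adds only `V.size + 1` to the term, so
      -- the total measure drops; likewise for `let` below.
      · simp only [traceSize, List.map_cons, List.sum_cons, size]
        omega
      · rw [(hval K hK).traceProb_app hV, Term.subst, hV.2.subst_eq_self]
    | @tens a b d L s hL hs =>
      refine (ih _ ?_ (.letp (Ctx.Split.empty_left Γ) hC hL) hs hρ rfl).congr fun K hK => ?_
      · simp only [traceSize, List.map_cons, List.sum_cons, size]
        omega
      · rw [(hval K hK).traceProb_tens hL, Term.subst]
        congr 2
        refine ((hL.subst_congr fun k e hk => ?_).trans (subst_var L)).symm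
        rcases k with _ | _ | k
        · rfl
        · rfl
        · exact nomatch hk
  · obtain ⟨m, hm⟩ := hρ.exists_fresh
    cases hC.progress oC hm with
    | zero h =>
      refine Testable.zero.congr fun K hK => ?_
      rw [traceProb_eq, h _ (hρ.closes hK), bind_zero]
    | mix h₁ h₂ s₁ s₂ h =>
      refine ((ih _ (by omega) h₁ hs hρ rfl).mix (ih _ (by omega) h₂ hs hρ rfl)).congr
        fun K hK => ?_
      rw [traceProb_eq, h _ (hρ.closes hK), bind_add, bind_smul, bind_smul]
      rfl
    | @app i Δ Θ a b X C' hsp hi oX hX h' s' h =>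
      refine (Testable.apply (g := fun V => traceProb (C'.subst V) s) hρ hsp hi oX hX
        (fun hV => congrArg (traceProb · s) (h'.subst_congr hV))
        fun T' ρ' hρ' => ih _ (by omega) h' hs hρ' rfl).congr fun K hK => ?_
      rw [traceProb_eq, h _ (hρ.closes hK), bind_bind]
      rfl
    | @split i a b C' hi h' s' h =>
      refine (Testable.split (g := fun V => traceProb (C'.subst V) s) hρ hi hm
        (fun hV => congrArg (traceProb · s) (h'.subst_congr hV))
        fun T' ρ' hρ' => ih _ (by omega) h' hs hρ' rfl).congr fun K hK => ?_
      rw [traceProb_eq, h _ (hρ.closes hK), bind_splitVal]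
      rfl

end Tuples

end AffineLambda

/-! ### The comparison of the two distances -/

theorem mainTheorem4 {Ty : Type*} (A : TypeAlgebra Ty) (I : List ℕ) (hI : I.Nodup)
    (a : ℕ → Ty) (b : Ty) (C : Term) (hC : Typed A (Ctx.ofList I a) C b)
    (V W : ℕ → Term) (hV : ∀ x ∈ I, ClosedValue A (V x) (a x))
    (hW : ∀ x ∈ I, ClosedValue A (W x) (a x)) :
    traceDist A b (C.subst V) (C.subst W) ≤ tupleDist A (I.map a) (I.map V) (I.map W) := by
  have hget : ∀ {x}, x ∈ I → I[I.idxOf x]? = some x := fun hx => by simp [hx]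
  have hmem : ∀ {x c}, Ctx.ofList I a x = some c → x ∈ I ∧ a x = c := by
    intro x c hx
    by_cases h : x ∈ I <;> simp_all [Ctx.ofList]
  -- Initially a variable is located at its index in the listing `I`.
  have hρ : Locates (Ctx.ofList I a) (I.map a) fun x => I.idxOf x := by
    refine ⟨fun {x c} hx => ?_, fun {x y c d} hx hy e => ?_⟩
    · obtain ⟨hxI, rfl⟩ := hmem hx
      rw [List.getElem?_map, hget hxI]
      rfl
    · exact (List.idxOf_inj (hmem hx).1).1 e
  have htuple : ∀ {V : ℕ → Term}, (∀ x ∈ I, ClosedValue A (V x) (a x)) →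
      TypedTuple A (I.map V) (I.map a) := by
    intro V hV
    rw [TypedTuple, List.forall₂_map_left_iff, List.forall₂_map_right_iff, List.forall₂_same]
    exact hV
  have henv : ∀ V : ℕ → Term, C.subst (env (I.map V) fun x => I.idxOf x) = C.subst V := by
    refine fun V => hC.subst_congr fun x c hx => env_eq ?_
    rw [List.getElem?_map, hget (hmem hx).1]
    rfl
  -- The empty trace shows that the set of differences is nonempty.
  refine csSup_le ⟨_, [], .nil, rfl⟩ ?_
  rintro d ⟨s, hs, rfl⟩
  simpa only [henv] using (hC.testable_traceProb hs hρ).abs_sub_le (htuple hV) (htuple hW)
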